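/- A \emph{rank-one construction} with parameters $h_1\ge 0$, $r_j$, $s_j(1),\dots,s_j(r_j)$ (all integers, $s_j(i)\ge 0$, $j=1,2,\dots$) is an invertible measure-preserving transformation $T$ of a standard probability space $(X,\mu)$ with measurable sets $E_1,E_2,\dots$ such that for every $j$: the sets $E_j,TE_j,\dots,T^{h_j}E_j$ (the tower of step $j$) are disjoint; $E_j$ is a disjoint union of sets $E_j^1,\dots,E_j^{r_j}$ of the same measure; the sets $T^kE_j^i$ ($1\le i\le r_j$, $0\le k\le h_j+s_j(i)$) are disjoint; $T^{h_j+s_j(i)+1}E_j^i=E_j^{i+1}$ for $i<r_j$; $E_{j+1}=E_j^1$ and $h_{j+1}+1=(h_j+1)r_j+\sum_{i=1}^{r_j}s_j(i)$; moreover, the towers exhaust $X$ up to a null set, and every measurable set is approximated in measure by unions of floors of the towers. The construction is \emph{bounded} if there are constants $r,s$ with $2<r_j<r$ and $0\le s_j(i)<s$ for all $j$ and $i$. \textbf{Theorem 2.} Let $T$ be a bounded rank-one construction on $(X,\mu)$ that is weakly mixing (that is, $T\times T$ is ergodic for $\mu\times\mu$), and let $q\ne p$ be nonnegative integers. Then $T^q$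 and $T^p$ are disjoint: the only $T^q\times T^p$-invariant measure $\nu$ on $X\times X$ with both marginals equal to $\mu$, i.e. $\nu(A\times X)=\nu(X\times A)=\mu(A)$ for all measurable $A$, is $\nu=\mu\times\mu$. -/

import Mathlib

open MeasureTheory

/-- Parameters of a rank-one construction: the height `h₁` of the top floor of the initial tower
(whose floors are numbered `0, …, h₁`), the cut numbers `r j`, and the spacer numbers `s j i`,
where `i = 0, …, r j - 1` numbers the columns at step `j` (steps are numbered from `0`). -/
structure RankOneData where
  h₁ : ℕ
  r : ℕ → ℕ
  s : ℕ → ℕ → ℕ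

namespace RankOneData

/-- The number of floors of the tower at step `j` (one more than the height of its top floor). -/
def floors (D : RankOneData) : ℕ → ℕ
  | 0 => D.h₁ + 1
  | j + 1 => D.floors j * D.r j + ∑ i ∈ Finset.range (D.r j), D.s j i

/-- Bounded parameters: `2 < r j < r₀` and `0 ≤ s j i < s₀` for all steps and columns. -/
def Bounded (D : RankOneData) : Prop :=
  ∃ r₀ s₀ : ℕ, ∀ j, 2 < D.r j ∧ D.r j < r₀ ∧ ∀ i < D.r j, D.s j i < s₀

end RankOneData

/-- `T` is built by cutting and stacking with parameters `D`; `E j` is the base of the tower at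
step `j`, and `C j i` (for `i < D.r j`) is the base of its `i`-th column. -/
structure IsCuttingStacking {X : Type*} [MeasurableSpace X] (D : RankOneData) (T : X ≃ᵐ X)
    (μ : Measure X) (E : ℕ → Set X) (C : ℕ → ℕ → Set X) : Prop where
  measurableSet_base : ∀ j, MeasurableSet (E j)
  measurableSet_column : ∀ j, ∀ i < D.r j, MeasurableSet (C j i)
  /-- The floors `E j, T (E j), …` of the tower at step `j` are disjoint. -/
  disjoint_floors : ∀ j, {k : ℕ | k < D.floors j}.PairwiseDisjoint fun k => T^[k] '' E j
  /-- The base is cut into `r j` pieces, disjoint and of the same measure. -/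
  cut : ∀ j, E j = ⋃ i ∈ Finset.range (D.r j), C j i
  disjoint_cut : ∀ j, {i : ℕ | i < D.r j}.PairwiseDisjoint (C j)
  measure_cut : ∀ j, ∀ i < D.r j, μ (C j i) = μ (E j) / D.r j
  /-- All floors of all columns, `s j i` spacers over the `i`-th one included, are disjoint. -/
  disjoint_columns : ∀ j, {x : ℕ × ℕ | x.1 < D.r j ∧ x.2 < D.floors j + D.s j x.1}.PairwiseDisjoint
    fun x => T^[x.2] '' C j x.1
  /-- The column `i + 1` is stacked over the column `i` with its spacers. -/
  stack : ∀ j i, i + 1 < D.r j → T^[D.floors j + D.s j i] '' C j i = C j (i + 1)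
  /-- The base of the next tower is the base of the first column. -/
  next_base : ∀ j, E (j + 1) = C j 0
  /-- The towers exhaust the space. -/
  exhaust : μ (⋃ j, ⋃ k ∈ Finset.range (D.floors j), T^[k] '' E j)ᶜ = 0
  /-- The floors approximate all measurable sets (in the interval model, their lengths tend
  to `0`). -/
  generate : ∀ A, MeasurableSet A → ∀ ε > 0, ∃ j, ∃ S ⊆ Finset.range (D.floors j),
    μ (symmDiff A (⋃ k ∈ S, T^[k] '' E j)) < ε

/-- The invertible measure-preserving transformation `T` of `(X, μ)` is (a realization of) the
rank-one construction with parameters `D`. -/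
def IsRankOneConstruction {X : Type*} [MeasurableSpace X] (D : RankOneData) (T : X ≃ᵐ X)
    (μ : Measure X) : Prop :=
  MeasurePreserving T μ μ ∧ ∃ E C, IsCuttingStacking D T μ E C

/-- `T` is a bounded rank-one construction. -/
def IsBoundedConstruction {X : Type*} [MeasurableSpace X] (T : X ≃ᵐ X) (μ : Measure X) : Prop :=
  ∃ D : RankOneData, D.Bounded ∧ IsRankOneConstruction D T μ

/-- `T` is weakly mixing: `T × T` is ergodic for `μ × μ`. -/
def IsWeaklyMixing {X : Type*} [MeasurableSpace X] (T : X → X) (μ : Measure X) : Prop :=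
  Ergodic (Prod.map T T) (μ.prod μ)

/-- `ν` is a joining of `(X, μ, S)` and `(Y, μ', T)`: an `S × T`-invariant measure on `X × Y`
whose marginals are `μ` and `μ'`. -/
structure IsJoining {X Y : Type*} [MeasurableSpace X] [MeasurableSpace Y] (S : X → X) (T : Y → Y)
    (μ : Measure X) (μ' : Measure Y) (ν : Measure (X × Y)) : Prop where
  invariant : MeasurePreserving (Prod.map S T) ν ν
  map_fst : ν.map Prod.fst = μ
  map_snd : ν.map Prod.snd = μ'

/-- Disjointness: the only joining is the product measure. -/
def AreDisjoint {X Y : Type*} [MeasurableSpace X] [MeasurableSpace Y] (S : X → X) (T : Y → Y)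
    (μ : Measure X) (μ' : Measure Y) : Prop :=
  ∀ ν : Measure (X × Y), IsJoining S T μ μ' ν → ν = μ.prod μ'

/-!
A joining of `T^[p]` and `T^[q]` is treated through its values on measurable rectangles, as a
*joining form*: a nonnegative, separately finitely additive, invariant function of two sets with
marginals `μ`. Joining forms are a compact convex set for pointwise convergence, so by the
Krein–Milman theorem it is enough to consider an extreme form `β`
(`IsJoiningForm.eq_of_forall_extreme`). Extremality replaces ergodicity of the joining: if sets
`P j`, `Q j` are asymptotically invariant, then restricting `β` to `P j × Q j` multiplies it, in the
limit, by a constant (`exists_tendsto_inter_of_extreme`).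

Let `H` be the number of floors of the tower of step `j`. After time `k * H` a point has come back
to its floor up to a number `m` of spacers, which is tight because the parameters are bounded; the
set of points with a given `m` is `returnSet`. Move a pair `(x, y)` by `T^[p] × T^[q]` for
time `t * H`. On the pairs that pass `m` and `n` spacers the motion looks like a shift by `(-m, -n)`,
so if these pairs do not vanish asymptotically, `β` is invariant under `T^[m] × T^[n]`. Unless
`q * m = p * n`, this makes `β` invariant under a power of `T` in one variable, and `β` is the
product since `T` is totally ergodic (`IsCuttingStacking.tendsto_form_returnSet`).

Suppose `β` is not the product, and write `p = d * p'`, `q = d * q'` with `p'` and `q'` coprime and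
`q' ≥ 2`. The relation `q' * m = p' * n` for all `t` propagates divisibility: with probability
tending to one, the number of spacers passed before the return number `d * q' ^ k` is
divisible by `q' ^ k` (`IsCuttingStacking.tendsto_measure_returnSet_of_not_dvd`). Since the numbers
of spacers that occur within a bounded number of steps grow linearly, and `q' ^ k` exponentially,
the sequence of spacer numbers is periodic on long stretches, and hence constant from some step on
(`IsCuttingStacking.eventually_exists_offset_two_succ`). Then the base of a late tower is invariant
under a power of `T`, which contradicts total ergodicity
(`IsCuttingStacking.false_of_offset_two_succ`).
-/

section

open Set Filter Topology
open scoped symmDiff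

variable {X : Type*} [MeasurableSpace X]

/-! ### Ergodicity -/

/-- An ergodic transformation has, up to a factor, only one invariant finitely additive set
function dominated by the invariant measure: domination makes the set function countably additive
and absolutely continuous. -/
theorem Ergodic.eq_mul_of_le_measure {μ : Measure X} [IsProbabilityMeasure μ] {S : X → X}
    (hS : Ergodic S μ) {l : Set X → ℝ}
    (hadd : ∀ A B, MeasurableSet A → MeasurableSet B → Disjoint A B → l (A ∪ B) = l A + l B)
    (h0 : ∀ A, MeasurableSet A → 0 ≤ l A) (hle : ∀ A, MeasurableSet A → l A ≤ μ.real A)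
    (hinv : ∀ A, MeasurableSet A → l (S ⁻¹' A) = l A) {A : Set X} (hA : MeasurableSet A) :
    l A = l univ * μ.real A := by
  have hempty : l ∅ = 0 := by
    have := hadd ∅ ∅ .empty .empty (disjoint_empty _)
    simp only [union_self] at this
    linarith
  have hfin : ∀ f : ℕ → Set X, (∀ i, MeasurableSet (f i)) → Pairwise (Function.onFun Disjoint f) →
      ∀ n, l (⋃ i ∈ Finset.range n, f i) = ∑ i ∈ Finset.range n, l (f i) := by
    intro f hf hd n
    induction n with
    | zero => simpa using hempty
    | succ n ih =>
      rw [Finset.sum_range_succ, ← ih, ← hadd _ _ (Finset.measurableSet_biUnion _ fun i _ => hf i)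
        (hf n)]
      · congr 1
        ext x
        simp only [Finset.mem_range, mem_iUnion, mem_union, exists_prop, Nat.lt_succ_iff_lt_or_eq]
        constructor
        · rintro ⟨i, hi | rfl, hx⟩
          exacts [.inl ⟨i, hi, hx⟩, .inr hx]
        · rintro (⟨i, hi, hx⟩ | hx)
          exacts [⟨i, .inl hi, hx⟩, ⟨n, .inr rfl, hx⟩]
      · rw [disjoint_iUnion₂_left]
        intro i hi
        exact hd (Finset.mem_range.1 hi).ne
  have hsum : ∀ f : ℕ → Set X, (∀ i, MeasurableSet (f i)) → Pairwise (Function.onFun Disjoint f) →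
      HasSum (fun i => l (f i)) (l (⋃ i, f i)) := by
    intro f hf hd
    rw [hasSum_iff_tendsto_nat_of_nonneg fun i => h0 _ (hf i)]
    have hμ : Tendsto (fun n => ∑ i ∈ Finset.range n, μ.real (f i)) atTop
        (𝓝 (μ.real (⋃ i, f i))) :=
      (hasSum_iff_tendsto_nat_of_nonneg (fun i => measureReal_nonneg) _).1 <| by
        have h := measure_iUnion (μ := μ) hd hf
        have h' := ENNReal.hasSum_toReal (h ▸ measure_ne_top μ _)
        rwa [← ENNReal.tsum_toReal_eq fun i => measure_ne_top μ _, ← h] at h'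
    have key : ∀ n, l (⋃ i, f i) - (μ.real (⋃ i, f i) - ∑ i ∈ Finset.range n, μ.real (f i)) ≤
        ∑ i ∈ Finset.range n, l (f i) ∧ ∑ i ∈ Finset.range n, l (f i) ≤ l (⋃ i, f i) := by
      intro n
      have hm : MeasurableSet (⋃ i ∈ Finset.range n, f i) :=
        Finset.measurableSet_biUnion _ fun i _ => hf i
      have hm' := (MeasurableSet.iUnion hf).diff hm
      have hsub : (⋃ i ∈ Finset.range n, f i) ⊆ ⋃ i, f i := iUnion₂_subset_iUnion _ _
      have h1 := hadd _ _ hm hm' disjoint_sdiff_right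
      rw [union_sdiff_cancel hsub, hfin f hf hd] at h1
      have h2 := hle _ hm'
      have h3 := h0 _ hm'
      rw [measureReal_sdiff hsub hm, measureReal_biUnion_finset (fun i _ j _ h => hd h)
        fun i _ => hf i] at h2
      constructor <;> linarith
    refine tendsto_of_tendsto_of_tendsto_of_le_of_le ?_ tendsto_const_nhds (fun n => (key n).1)
      fun n => (key n).2
    have := (tendsto_const_nhds (x := μ.real (⋃ i, f i))).sub hμ
    simpa using (tendsto_const_nhds (x := l (⋃ i, f i))).sub this
  set ρ : Measure X := Measure.ofMeasurable (fun A _ => ENNReal.ofReal (l A)) (by simp [hempty])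
    (fun f hf hd => by
      rw [← (hsum f hf hd).tsum_eq,
        ENNReal.ofReal_tsum_of_nonneg (fun i => h0 _ (hf i)) (hsum f hf hd).summable]) with hρ
  have hρA : ∀ A, MeasurableSet A → ρ A = ENNReal.ofReal (l A) := fun A hA =>
    Measure.ofMeasurable_apply A hA
  have hρle : ρ ≤ μ := by
    refine Measure.le_intro fun A hA _ => ?_
    rw [hρA A hA]
    exact ENNReal.ofReal_le_of_le_toReal (hle A hA)
  have : IsFiniteMeasure ρ := isFiniteMeasure_of_le μ hρle
  have hpres : MeasurePreserving S ρ ρ := by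
    refine ⟨hS.measurable, ?_⟩
    ext A hA
    rw [Measure.map_apply hS.measurable hA, hρA A hA, hρA _ (hS.measurable hA), hinv A hA]
  obtain ⟨c, hc⟩ := hS.eq_smul_of_absolutelyContinuous hpres hρle.absolutelyContinuous
  have hreal : ∀ A, MeasurableSet A → l A = c.toReal * μ.real A := by
    intro A hA
    have := hρA A hA
    rw [hc, Measure.smul_apply, smul_eq_mul] at this
    rw [← ENNReal.toReal_ofReal (h0 A hA), ← this, ENNReal.toReal_mul, Measure.real]
  rw [hreal A hA, hreal univ .univ]
  simp

/-- Weak mixing implies total ergodicity. For a centred function `f`, invariant under `T^[k]`,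
the sum of `f (T^[i] x) * f (T^[i] y)` over `i < k` is `T × T`-invariant, hence zero, while its
inner product with `f x * f y` is the sum of the squares of the autocorrelations of `f`. -/
theorem IsWeaklyMixing.ergodic_iterate {μ : Measure X} [IsProbabilityMeasure μ] {T : X → X}
    (hT : MeasurePreserving T μ μ) (hw : IsWeaklyMixing T μ) {k : ℕ} (hk : 0 < k) :
    Ergodic T^[k] μ := by
  refine ⟨hT.iterate k, ⟨fun A hA hinv => ?_⟩⟩
  set f : X → ℝ := fun x => A.indicator 1 x - μ.real A with hf
  have hfm : Measurable f := (measurable_one.indicator hA).sub_const _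
  have hfb : ∀ x, ‖f x‖ ≤ 2 := by
    intro x
    have h1 : μ.real A ≤ 1 := measureReal_le_one
    have h2 : 0 ≤ μ.real A := measureReal_nonneg
    rw [hf, Real.norm_eq_abs, abs_le]
    by_cases hx : x ∈ A <;> simp [hx] <;> constructor <;> linarith
  have hfT : ∀ i, Measurable fun x => f (T^[i] x) := fun i => hfm.comp (hT.iterate i).measurable
  have hint : ∀ g : X → ℝ, Measurable g → (∃ C, ∀ x, ‖g x‖ ≤ C) → Integrable g μ :=
    fun g hg ⟨C, hC⟩ => Integrable.of_bound hg.aestronglyMeasurable C (.of_forall hC)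
  have hfi : ∀ i, Integrable (fun x => f (T^[i] x)) μ := fun i => hint _ (hfT i) ⟨2, fun x => hfb _⟩
  have hf0 : ∫ x, f x ∂μ = 0 := by
    have h1 : ∫ x, A.indicator (1 : X → ℝ) x ∂μ = μ.real A := integral_indicator_one hA
    have h2 : Integrable (A.indicator (1 : X → ℝ)) μ :=
      (integrable_const (1 : ℝ)).indicator hA
    simp only [hf]
    rw [integral_sub h2 (integrable_const _), h1]
    simp
  have hf0' : ∀ i, ∫ x, f (T^[i] x) ∂μ = 0 := fun i => by
    rw [← integral_map (hT.iterate i).measurable.aemeasurable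
      (by rw [(hT.iterate i).map_eq]; exact hfm.aestronglyMeasurable), (hT.iterate i).map_eq, hf0]
  have hfk : ∀ x, f (T^[k] x) = f x := fun x => by
    have : T^[k] x ∈ A ↔ x ∈ A := by rw [← mem_preimage, hinv]
    by_cases hx : x ∈ A <;> simp [hf, this, hx]
  set F : X × X → ℝ := fun z => ∑ i ∈ Finset.range k, f (T^[i] z.1) * f (T^[i] z.2) with hF
  have hFm : Measurable F := Finset.measurable_sum _ fun i _ =>
    ((hfT i).comp measurable_fst).mul ((hfT i).comp measurable_snd)
  have hFT : F ∘ Prod.map T T = F := by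
    funext z
    simp only [hF, Function.comp, Prod.map]
    have h1 := Finset.sum_range_succ (fun i => f (T^[i] z.1) * f (T^[i] z.2)) k
    rw [Finset.sum_range_succ'] at h1
    simp only [hfk, Function.iterate_succ_apply, Function.iterate_zero, id] at h1
    exact add_right_cancel h1
  obtain ⟨c, hc⟩ := hw.ae_eq_const_of_ae_eq_comp_ae hFm.aestronglyMeasurable
    (Eventually.of_forall fun z => congrFun hFT z)
  have hprod : ∀ g h : X → ℝ, Measurable g → Measurable h → (∃ C, ∀ x, ‖g x‖ ≤ C) →
      (∃ C, ∀ x, ‖h x‖ ≤ C) → Integrable (fun z : X × X => g z.1 * h z.2) (μ.prod μ) :=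
    fun g h hg hh hg' hh' => (hint g hg hg').mul_prod (hint h hh hh')
  have hc0 : c = 0 := by
    have h1 : ∫ z, F z ∂(μ.prod μ) = c := by rw [integral_congr_ae hc]; simp
    rw [← h1, hF, integral_finsetSum _ fun i _ =>
      hprod _ _ (hfT i) (hfT i) ⟨2, fun x => hfb _⟩ ⟨2, fun x => hfb _⟩]
    refine Finset.sum_eq_zero fun i _ => ?_
    rw [integral_prod_mul (fun x => f (T^[i] x)) (fun x => f (T^[i] x)), hf0', zero_mul]
  have hbb : ∀ i, ∃ C, ∀ x, ‖f (T^[i] x) * f x‖ ≤ C := fun i => ⟨2 * 2, fun x => by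
    rw [norm_mul]
    exact mul_le_mul (hfb _) (hfb _) (norm_nonneg _) zero_le_two⟩
  have hsq : ∑ i ∈ Finset.range k, (∫ x, f (T^[i] x) * f x ∂μ) ^ 2 = 0 := by
    have h1 : ∫ z, F z * (f z.1 * f z.2) ∂(μ.prod μ) = 0 := by
      rw [integral_congr_ae (g := fun _ => (0 : ℝ))]
      · simp
      · filter_upwards [hc] with z hz
        simp [hz, hc0]
    rw [← h1]
    have h2 : ∀ z : X × X, F z * (f z.1 * f z.2) = ∑ i ∈ Finset.range k,
        (f (T^[i] z.1) * f z.1) * (f (T^[i] z.2) * f z.2) := fun z => by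
      rw [hF, Finset.sum_mul]
      exact Finset.sum_congr rfl fun i _ => by ring
    simp_rw [h2]
    rw [integral_finsetSum _ fun i _ => hprod (fun x => f (T^[i] x) * f x)
      (fun x => f (T^[i] x) * f x) ((hfT i).mul hfm) ((hfT i).mul hfm) (hbb i) (hbb i)]
    refine Finset.sum_congr rfl fun i _ => ?_
    rw [integral_prod_mul (fun x => f (T^[i] x) * f x) (fun x => f (T^[i] x) * f x), sq]
  have hzero : ∫ x, f x * f x ∂μ = 0 := by
    have := (Finset.sum_eq_zero_iff_of_nonneg fun i _ => sq_nonneg _).1 hsq 0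
      (Finset.mem_range.2 hk)
    simpa using this
  rw [integral_eq_zero_iff_of_nonneg (fun x => mul_self_nonneg _) (hint _ (hfm.mul hfm) (hbb 0))]
    at hzero
  rw [eventuallyConst_set]
  have hA' : ∀ᵐ x ∂μ, A.indicator 1 x = μ.real A := by
    filter_upwards [hzero] with x hx
    exact sub_eq_zero.1 (mul_self_eq_zero.1 hx)
  by_cases h1 : μ.real A = 1
  · left
    filter_upwards [hA'] with x hx
    by_contra hxA
    simp [hxA, h1] at hx
  · right
    filter_upwards [hA'] with x hx hxA
    simp only [hxA, indicator_of_mem, Pi.one_apply] at hx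
    exact h1 hx.symm

/-! ### Joinings as set functions on pairs of sets -/

section

/-- A nonnegative function of pairs of measurable sets, finitely additive in either variable and
invariant under `S × U`. Countable additivity and an extension to `X × X` are not required, so that
such functions are closed under pointwise limits. They vanish, by convention, if one of the sets
is not measurable. -/
structure IsInvariantForm (S U : X → X) (β : Set X → Set X → ℝ) : Prop where
  union_left : ∀ A A' B, MeasurableSet A → MeasurableSet A' → MeasurableSet B → Disjoint A A' →
    β (A ∪ A') B = β A B + β A' B
  union_right : ∀ A B B', MeasurableSet A → MeasurableSet B → MeasurableSet B' → Disjoint B B' →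
    β A (B ∪ B') = β A B + β A B'
  nonneg : ∀ A B, 0 ≤ β A B
  eq_zero : ∀ A B, ¬(MeasurableSet A ∧ MeasurableSet B) → β A B = 0
  preimage : ∀ A B, MeasurableSet A → MeasurableSet B → β (S ⁻¹' A) (U ⁻¹' B) = β A B

/-- An invariant form both of whose marginals are `μ`. -/
structure IsJoiningForm (μ : Measure X) (S U : X → X) (β : Set X → Set X → ℝ) : Prop
    extends IsInvariantForm S U β where
  univ_left : ∀ B, MeasurableSet B → β univ B = μ.real B
  univ_right : ∀ A, MeasurableSet A → β A univ = μ.real A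

namespace IsInvariantForm

variable {S U : X → X} {β γ : Set X → Set X → ℝ}

theorem mono (h : IsInvariantForm S U β) {A A' B B' : Set X} (hA : MeasurableSet A)
    (hA' : MeasurableSet A') (hB : MeasurableSet B) (hB' : MeasurableSet B') (hAA : A ⊆ A')
    (hBB : B ⊆ B') : β A B ≤ β A' B' := by
  have h1 := h.union_left A (A' \ A) B hA (hA'.diff hA) hB disjoint_sdiff_right
  have h2 := h.union_right A' B (B' \ B) hA' hB (hB'.diff hB) disjoint_sdiff_right
  rw [union_sdiff_cancel hAA] at h1
  rw [union_sdiff_cancel hBB] at h2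
  linarith [h.nonneg (A' \ A) B, h.nonneg A' (B' \ B)]

theorem smul (h : IsInvariantForm S U β) {c : ℝ} (hc : 0 ≤ c) : IsInvariantForm S U (c • β) where
  union_left A A' B hA hA' hB hd := by simp [h.union_left A A' B hA hA' hB hd, mul_add]
  union_right A B B' hA hB hB' hd := by simp [h.union_right A B B' hA hB hB' hd, mul_add]
  nonneg A B := mul_nonneg hc (h.nonneg A B)
  eq_zero A B hAB := by simp [h.eq_zero A B hAB]
  preimage A B hA hB := by simp [h.preimage A B hA hB]

theorem add (h : IsInvariantForm S U β) (h' : IsInvariantForm S U γ) :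
    IsInvariantForm S U (β + γ) where
  union_left A A' B hA hA' hB hd := by
    simp only [Pi.add_apply, h.union_left A A' B hA hA' hB hd, h'.union_left A A' B hA hA' hB hd]
    ring
  union_right A B B' hA hB hB' hd := by
    simp only [Pi.add_apply, h.union_right A B B' hA hB hB' hd,
      h'.union_right A B B' hA hB hB' hd]
    ring
  nonneg A B := add_nonneg (h.nonneg A B) (h'.nonneg A B)
  eq_zero A B hAB := by simp [h.eq_zero A B hAB, h'.eq_zero A B hAB]
  preimage A B hA hB := by simp [h.preimage A B hA hB, h'.preimage A B hA hB]

theorem sub (h : IsInvariantForm S U β) (h' : IsInvariantForm S U γ) (hle : ∀ A B, γ A B ≤ β A B) :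
    IsInvariantForm S U (β - γ) where
  union_left A A' B hA hA' hB hd := by
    simp only [Pi.sub_apply, h.union_left A A' B hA hA' hB hd, h'.union_left A A' B hA hA' hB hd]
    ring
  union_right A B B' hA hB hB' hd := by
    simp only [Pi.sub_apply, h.union_right A B B' hA hB hB' hd,
      h'.union_right A B B' hA hB hB' hd]
    ring
  nonneg A B := sub_nonneg.2 (hle A B)
  eq_zero A B hAB := by simp [h.eq_zero A B hAB, h'.eq_zero A B hAB]
  preimage A B hA hB := by simp [h.preimage A B hA hB, h'.preimage A B hA hB]

theorem eq_zero_of_univ (h : IsInvariantForm S U β) (h0 : β univ univ = 0) : β = 0 := by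
  funext A B
  by_cases hAB : MeasurableSet A ∧ MeasurableSet B
  · exact le_antisymm ((h.mono hAB.1 .univ hAB.2 .univ (subset_univ _) (subset_univ _)).trans h0.le)
      (h.nonneg A B)
  · exact h.eq_zero A B hAB

end IsInvariantForm

namespace IsJoiningForm

variable {μ : Measure X} {S U : X → X} {β γ : Set X → Set X → ℝ}

theorem le_left (h : IsJoiningForm μ S U β) {A B : Set X} (hA : MeasurableSet A)
    (hB : MeasurableSet B) : β A B ≤ μ.real A :=
  h.univ_right A hA ▸ h.mono hA hA hB .univ subset_rfl (subset_univ _)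

theorem le_right (h : IsJoiningForm μ S U β) {A B : Set X} (hA : MeasurableSet A)
    (hB : MeasurableSet B) : β A B ≤ μ.real B :=
  h.univ_left B hB ▸ h.mono hA .univ hB hB (subset_univ _) subset_rfl

variable [IsProbabilityMeasure μ]

theorem le_one (h : IsJoiningForm μ S U β) (A B : Set X) : β A B ≤ 1 := by
  by_cases hAB : MeasurableSet A ∧ MeasurableSet B
  · exact (h.le_left hAB.1 hAB.2).trans measureReal_le_one
  · exact (h.eq_zero A B hAB).trans_le zero_le_one

theorem le_add_symmDiff (h : IsJoiningForm μ S U β) {A A' B B' : Set X} (hA : MeasurableSet A)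
    (hA' : MeasurableSet A') (hB : MeasurableSet B) (hB' : MeasurableSet B') :
    β A B ≤ β A' B' + (μ.real (A ∆ A') + μ.real (B ∆ B')) := by
  have h1 : β A B ≤ β (A' ∪ A \ A') (B' ∪ B \ B') :=
    h.mono hA (hA'.union (hA.diff hA')) hB (hB'.union (hB.diff hB'))
      (by rw [union_sdiff_self]; exact subset_union_right)
      (by rw [union_sdiff_self]; exact subset_union_right)
  rw [h.union_left _ _ _ hA' (hA.diff hA') (hB'.union (hB.diff hB')) disjoint_sdiff_right,
    h.union_right _ _ _ hA' hB' (hB.diff hB') disjoint_sdiff_right] at h1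
  have h2 := h.le_right hA' (hB.diff hB')
  have h3 := h.le_left (hA.diff hA') (hB'.union (hB.diff hB'))
  have h4 : μ.real (A \ A') ≤ μ.real (A ∆ A') := measureReal_mono subset_union_left
  have h5 : μ.real (B \ B') ≤ μ.real (B ∆ B') := measureReal_mono subset_union_left
  linarith

theorem abs_sub_le (h : IsJoiningForm μ S U β) {A A' B B' : Set X} (hA : MeasurableSet A)
    (hA' : MeasurableSet A') (hB : MeasurableSet B) (hB' : MeasurableSet B') :
    |β A B - β A' B'| ≤ μ.real (A ∆ A') + μ.real (B ∆ B') := by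
  rw [abs_sub_le_iff]
  have h1 := h.le_add_symmDiff hA hA' hB hB'
  have h2 := h.le_add_symmDiff hA' hA hB' hB
  rw [symmDiff_comm A' A, symmDiff_comm B' B] at h2
  constructor <;> linarith

end IsJoiningForm

variable {μ : Measure X} {S U : X → X}

theorem convex_joiningForm : Convex ℝ {β | IsJoiningForm μ S U β} := by
  intro β hβ γ hγ a b ha hb hab
  refine ⟨(hβ.toIsInvariantForm.smul ha).add (hγ.toIsInvariantForm.smul hb), fun B hB => ?_,
    fun A hA => ?_⟩
  · simp only [Pi.add_apply, Pi.smul_apply, smul_eq_mul, hβ.univ_left B hB, hγ.univ_left B hB]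
    rw [← add_mul, hab, one_mul]
  · simp only [Pi.add_apply, Pi.smul_apply, smul_eq_mul, hβ.univ_right A hA, hγ.univ_right A hA]
    rw [← add_mul, hab, one_mul]

variable [IsProbabilityMeasure μ]

theorem isCompact_joiningForm : IsCompact {β | IsJoiningForm μ S U β} := by
  have hc : IsCompact {β : Set X → Set X → ℝ | ∀ A, β A ∈ {f | ∀ B, f B ∈ Icc (0 : ℝ) 1}} :=
    isCompact_pi_infinite fun A => isCompact_pi_infinite fun B => isCompact_Icc
  refine hc.of_isClosed_subset ?_ fun β hβ A B => ⟨hβ.nonneg A B, hβ.le_one A B⟩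
  have hcont : ∀ A B, Continuous fun β : Set X → Set X → ℝ => β A B := fun A B => by fun_prop
  have : {β | IsJoiningForm μ S U β} =
      {β | ∀ A A' B, MeasurableSet A → MeasurableSet A' → MeasurableSet B → Disjoint A A' →
        β (A ∪ A') B = β A B + β A' B} ∩
      {β | ∀ A B B', MeasurableSet A → MeasurableSet B → MeasurableSet B' → Disjoint B B' →
        β A (B ∪ B') = β A B + β A B'} ∩
      {β | ∀ A B, 0 ≤ β A B} ∩
      {β | ∀ A B, ¬(MeasurableSet A ∧ MeasurableSet B) → β A B = 0} ∩
      {β | ∀ A B, MeasurableSet A → MeasurableSet B → β (S ⁻¹' A) (U ⁻¹' B) = β A B} ∩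
      {β | ∀ B, MeasurableSet B → β univ B = μ.real B} ∩
      {β | ∀ A, MeasurableSet A → β A univ = μ.real A} := by
    ext β
    exact ⟨fun h => ⟨⟨⟨⟨⟨⟨h.1.1, h.1.2⟩, h.1.3⟩, h.1.4⟩, h.1.5⟩, h.2⟩, h.3⟩,
      fun h => ⟨⟨h.1.1.1.1.1.1, h.1.1.1.1.1.2, h.1.1.1.1.2, h.1.1.1.2, h.1.1.2⟩, h.1.2, h.2⟩⟩
  rw [this]
  simp only [ofPred_forall]
  refine (((((IsClosed.inter ?_ ?_).inter ?_).inter ?_).inter ?_).inter ?_).inter ?_ <;>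
  repeat' first
    | refine isClosed_iInter fun _ => ?_
    | exact isClosed_le continuous_const (hcont _ _)
    | exact isClosed_eq (hcont _ _) continuous_const
    | exact isClosed_eq (hcont _ _) (hcont _ _)
    | exact isClosed_eq (hcont _ _) ((hcont _ _).add (hcont _ _))

/-- By the Krein–Milman theorem a system of joining forms whose extreme points all coincide is
a single form. -/
theorem IsJoiningForm.eq_of_forall_extreme {β₀ : Set X → Set X → ℝ}
    (h : ∀ β ∈ extremePoints ℝ {β | IsJoiningForm μ S U β}, β = β₀) {β : Set X → Set X → ℝ}
    (hβ : IsJoiningForm μ S U β) : β = β₀ := by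
  have h1 := closure_convexHull_extremePoints (isCompact_joiningForm (μ := μ) (S := S) (U := U))
    convex_joiningForm
  have h2 : β ∈ closure (convexHull ℝ (extremePoints ℝ {β | IsJoiningForm μ S U β})) := by
    rw [h1]
    exact hβ
  have h3 : closure (convexHull ℝ (extremePoints ℝ {β | IsJoiningForm μ S U β})) ⊆ {β₀} :=
    closure_minimal (convexHull_min (fun γ hγ => h γ hγ) (convex_singleton _)) isClosed_singleton
  exact h3 h2

/-- Extreme joining forms are ergodic: an invariant form below an extreme one is proportional
to it. Ergodicity of the factors takes care of the marginals. -/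
theorem IsInvariantForm.eq_smul_of_le_extreme (hS : Ergodic S μ) (hU : Ergodic U μ)
    {β γ : Set X → Set X → ℝ} (hβ : β ∈ extremePoints ℝ {β | IsJoiningForm μ S U β})
    (hγ : IsInvariantForm S U γ) (hle : ∀ A B, γ A B ≤ β A B) : γ = γ univ univ • β := by
  have hβ' : IsJoiningForm μ S U β := hβ.1
  set c := γ univ univ with hc
  have hsub : IsInvariantForm S U (β - γ) := hβ'.toIsInvariantForm.sub hγ hle
  have hβ1 : β univ univ = 1 := by simp [hβ'.univ_left univ .univ]
  have hleft : ∀ A, MeasurableSet A → γ A univ = c * μ.real A := fun A hA =>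
    hS.eq_mul_of_le_measure (l := fun A => γ A univ)
      (fun A B hA hB hd => hγ.union_left _ _ _ hA hB .univ hd) (fun A _ => hγ.nonneg _ _)
      (fun A hA => (hle _ _).trans (hβ'.univ_right A hA).le)
      (fun A hA => by simpa using hγ.preimage A univ hA .univ) hA
  have hright : ∀ A, MeasurableSet A → γ univ A = c * μ.real A := fun A hA =>
    hU.eq_mul_of_le_measure (l := fun A => γ univ A)
      (fun A B hA hB hd => hγ.union_right _ _ _ .univ hA hB hd) (fun A _ => hγ.nonneg _ _)
      (fun A hA => (hle _ _).trans (hβ'.univ_left A hA).le)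
      (fun A hA => by simpa using hγ.preimage univ A .univ hA) hA
  have hc0 : 0 ≤ c := hγ.nonneg _ _
  have hc1 : c ≤ 1 := hβ1 ▸ hle _ _
  rcases hc0.eq_or_lt with h0 | h0
  · rw [← h0, zero_smul]
    exact hγ.eq_zero_of_univ h0.symm
  rcases hc1.eq_or_lt with h1 | h1
  · rw [h1, one_smul]
    have := hsub.eq_zero_of_univ (by simp [hβ1, ← hc, h1])
    exact (sub_eq_zero.1 this).symm
  have h1' : 0 < 1 - c := sub_pos.2 h1
  have hγ₁ : IsJoiningForm μ S U (c⁻¹ • γ) :=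
    ⟨hγ.smul (inv_nonneg.2 hc0), fun B hB => by simp [hright B hB, h0.ne'],
      fun A hA => by simp [hleft A hA, h0.ne']⟩
  have hγ₂ : IsJoiningForm μ S U ((1 - c)⁻¹ • (β - γ)) := by
    refine ⟨hsub.smul (inv_nonneg.2 h1'.le), fun B hB => ?_, fun A hA => ?_⟩
    · simp only [Pi.smul_apply, Pi.sub_apply, hβ'.univ_left B hB, hright B hB, smul_eq_mul]
      field_simp
    · simp only [Pi.smul_apply, Pi.sub_apply, hβ'.univ_right A hA, hleft A hA, smul_eq_mul]
      field_simp
  have := (mem_extremePoints_iff_left.1 hβ).2 _ hγ₁ _ hγ₂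
    ⟨c, 1 - c, h0, h1', by ring, by
      rw [smul_inv_smul₀ h0.ne', smul_inv_smul₀ h1'.ne', add_sub_cancel]⟩
  rw [← this, smul_inv_smul₀ h0.ne']

/-- If `P j` and `Q j` are asymptotically invariant, restricting an extreme joining form to the
rectangles `P j × Q j` multiplies it by a constant in the limit. -/
theorem exists_tendsto_inter_of_extreme (hS : Ergodic S μ) (hU : Ergodic U μ)
    {β : Set X → Set X → ℝ} (hβ : β ∈ extremePoints ℝ {β | IsJoiningForm μ S U β})
    {ι : Type*} (l : Ultrafilter ι) {P Q : ι → Set X} (hP : ∀ j, MeasurableSet (P j))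
    (hQ : ∀ j, MeasurableSet (Q j))
    (hPinv : Tendsto (fun j => μ.real ((S ⁻¹' P j) ∆ P j)) l (𝓝 0))
    (hQinv : Tendsto (fun j => μ.real ((U ⁻¹' Q j) ∆ Q j)) l (𝓝 0)) :
    ∃ c : ℝ, ∀ A B, MeasurableSet A → MeasurableSet B →
      Tendsto (fun j => β (A ∩ P j) (B ∩ Q j)) l (𝓝 (c * β A B)) := by
  classical
  have hβ' : IsJoiningForm μ S U β := hβ.1
  have hlim : ∀ A B, ∃ x, Tendsto (fun j => if MeasurableSet A ∧ MeasurableSet B then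
      β (A ∩ P j) (B ∩ Q j) else 0) l (𝓝 x) := by
    intro A B
    have := isCompact_Icc.ultrafilter_le_nhds (s := Icc (0 : ℝ) 1)
      (l.map fun j => if MeasurableSet A ∧ MeasurableSet B then β (A ∩ P j) (B ∩ Q j) else 0)
      (by
        rw [le_principal_iff]
        refine mem_map.2 (univ_mem' fun j => ?_)
        by_cases h : MeasurableSet A ∧ MeasurableSet B
        · simpa [h] using ⟨hβ'.nonneg _ _, hβ'.le_one _ _⟩
        · simp [h])
    obtain ⟨x, -, hx⟩ := this
    exact ⟨x, hx⟩
  choose γ hγ using hlim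
  have hγ' : ∀ A B, MeasurableSet A → MeasurableSet B →
      Tendsto (fun j => β (A ∩ P j) (B ∩ Q j)) l (𝓝 (γ A B)) := fun A B hA hB => by
    simpa [hA, hB] using hγ A B
  have hform : IsInvariantForm S U γ := by
    constructor
    · intro A A' B hA hA' hB hd
      refine tendsto_nhds_unique (hγ' _ _ (hA.union hA') hB)
        (((hγ' _ _ hA hB).add (hγ' _ _ hA' hB)).congr fun j => ?_)
      rw [union_inter_distrib_right, hβ'.union_left _ _ _ (hA.inter (hP j)) (hA'.inter (hP j))
        (hB.inter (hQ j)) (hd.mono inter_subset_left inter_subset_left)]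
    · intro A B B' hA hB hB' hd
      refine tendsto_nhds_unique (hγ' _ _ hA (hB.union hB'))
        (((hγ' _ _ hA hB).add (hγ' _ _ hA hB')).congr fun j => ?_)
      rw [union_inter_distrib_right, hβ'.union_right _ _ _ (hA.inter (hP j)) (hB.inter (hQ j))
        (hB'.inter (hQ j)) (hd.mono inter_subset_left inter_subset_left)]
    · intro A B
      refine ge_of_tendsto (hγ A B) (.of_forall fun j => ?_)
      split_ifs
      exacts [hβ'.nonneg _ _, le_rfl]
    · intro A B hAB
      exact tendsto_nhds_unique (hγ A B) (by simp [hAB])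
    · intro A B hA hB
      have hSA := hS.measurable hA
      have hUB := hU.measurable hB
      have h1 : Tendsto (fun j => β (S ⁻¹' A ∩ P j) (U ⁻¹' B ∩ Q j) - β (A ∩ P j) (B ∩ Q j)) l
          (𝓝 0) := by
        refine squeeze_zero_norm (fun j => ?_) (by simpa using hPinv.add hQinv)
        rw [← hβ'.preimage _ _ (hA.inter (hP j)) (hB.inter (hQ j)), Real.norm_eq_abs]
        refine (hβ'.abs_sub_le (hSA.inter (hP j)) (hS.measurable (hA.inter (hP j)))
          (hUB.inter (hQ j)) (hU.measurable (hB.inter (hQ j)))).trans ?_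
        rw [preimage_inter, preimage_inter, ← inter_symmDiff_distrib_left,
          ← inter_symmDiff_distrib_left, symmDiff_comm (P j), symmDiff_comm (Q j)]
        exact add_le_add (measureReal_mono inter_subset_right) (measureReal_mono inter_subset_right)
      exact sub_eq_zero.1 (tendsto_nhds_unique ((hγ' _ _ hSA hUB).sub (hγ' _ _ hA hB)) h1)
  have hle : ∀ A B, γ A B ≤ β A B := by
    intro A B
    by_cases hAB : MeasurableSet A ∧ MeasurableSet B
    · exact le_of_tendsto (hγ' _ _ hAB.1 hAB.2) (.of_forall fun j =>
        hβ'.mono (hAB.1.inter (hP j)) hAB.1 (hAB.2.inter (hQ j)) hAB.2 inter_subset_left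
          inter_subset_left)
    · rw [hform.eq_zero A B hAB]
      exact hβ'.nonneg A B
  refine ⟨γ univ univ, fun A B hA hB => ?_⟩
  have := congrFun (congrFun (hform.eq_smul_of_le_extreme hS hU hβ hle) A) B
  simp only [Pi.smul_apply, smul_eq_mul] at this
  rw [← this]
  exact hγ' A B hA hB


end

/-! ### Positions of the copies of a tower inside higher towers -/

namespace RankOneData

variable (D : RankOneData)

/-- The level at which the column `c` of the step `j` starts in the tower of step `j + 1`. -/
def colOffset (j c : ℕ) : ℕ := c * D.floors j + ∑ i ∈ Finset.range c, D.s j i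

/-- The number of copies of the tower of step `j` in the tower of step `j + L`. -/
def copies : ℕ → ℕ → ℕ
  | 0, _ => 1
  | L + 1, j => D.r j * copies L (j + 1)

/-- The level at which the `i`-th copy of the tower of step `j` starts in the tower of step
`j + L`; it is meaningful for `i < D.copies L j`. -/
def offset : ℕ → ℕ → ℕ → ℕ
  | 0, _, _ => 0
  | L + 1, j, i => offset L (j + 1) (i / D.r j) + D.colOffset j (i % D.r j)

theorem floors_pos_of_r_pos (hr : ∀ j, 0 < D.r j) (j : ℕ) : 0 < D.floors j := by
  induction j with
  | zero => exact Nat.succ_pos _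
  | succ j ih => exact Nat.add_pos_left (Nat.mul_pos ih (hr j)) _

theorem colOffset_r (j : ℕ) : D.colOffset j (D.r j) = D.floors (j + 1) := by
  rw [colOffset, floors, mul_comm]

@[simp] theorem colOffset_zero (j : ℕ) : D.colOffset j 0 = 0 := by simp [colOffset]

theorem colOffset_succ (j c : ℕ) :
    D.colOffset j (c + 1) = D.colOffset j c + (D.floors j + D.s j c) := by
  rw [colOffset, colOffset, Finset.sum_range_succ]
  ring

theorem add_colOffset_lt {j k c : ℕ} (hk : k < D.floors j) (hc : c < D.r j) :
    k + D.colOffset j c < D.floors (j + 1) := by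
  have h1 := D.colOffset_succ j c
  have h2 : D.colOffset j (c + 1) ≤ D.colOffset j (D.r j) := by
    rw [colOffset, colOffset]
    gcongr <;> exact hc
  rw [colOffset_r] at h2
  omega

theorem copies_pos (hr : ∀ j, 0 < D.r j) (L j : ℕ) : 0 < D.copies L j := by
  induction L generalizing j with
  | zero => exact Nat.one_pos
  | succ L ih => exact Nat.mul_pos (hr j) (ih _)

theorem three_pow_le_copies (hr : ∀ j, 2 < D.r j) (L j : ℕ) : 3 ^ L ≤ D.copies L j := by
  induction L generalizing j with
  | zero => exact le_rfl
  | succ L ih =>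
    rw [pow_succ', copies]
    exact Nat.mul_le_mul (hr j) (ih _)

theorem copies_le_pow {r₀ : ℕ} (hr : ∀ j, D.r j ≤ r₀) (L j : ℕ) : D.copies L j ≤ r₀ ^ L := by
  induction L generalizing j with
  | zero => exact le_rfl
  | succ L ih =>
    rw [pow_succ', copies]
    exact Nat.mul_le_mul (hr j) (ih _)

theorem copies_add (L M j : ℕ) : D.copies (L + M) j = D.copies L j * D.copies M (j + L) := by
  induction L generalizing j with
  | zero => simp [copies]
  | succ L ih =>
    rw [Nat.add_right_comm, copies, copies, ih, mul_assoc, Nat.add_right_comm j 1 L, add_assoc]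

@[simp] theorem offset_zero_right (L j : ℕ) : D.offset L j 0 = 0 := by
  induction L generalizing j with
  | zero => rfl
  | succ L ih => simp [offset, ih]

/-- The copies of the tower of step `j` in that of step `j + L + M` are grouped into copies of the
tower of step `j + L`. -/
theorem offset_add (hr : ∀ j, 0 < D.r j) (L M j c : ℕ) {i : ℕ} (hi : i < D.copies L j) :
    D.offset (L + M) j (D.copies L j * c + i) = D.offset M (j + L) c + D.offset L j i := by
  induction L generalizing j i with
  | zero =>
    obtain rfl : i = 0 := Nat.lt_one_iff.1 hi
    simp [copies, offset]
  | succ L ih =>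
    rw [copies] at hi
    have h1 : (D.copies (L + 1) j * c + i) / D.r j = D.copies L (j + 1) * c + i / D.r j := by
      rw [copies, mul_assoc, Nat.mul_add_div (hr j)]
    have h2 : (D.copies (L + 1) j * c + i) % D.r j = i % D.r j := by
      rw [copies, mul_assoc, Nat.mul_add_mod]
    rw [Nat.add_right_comm, offset, h1, h2, ih _ (Nat.div_lt_of_lt_mul hi), offset,
      Nat.add_right_comm j 1 L, add_assoc, add_assoc]

/-- The number of spacers between consecutive copies of a tower is bounded, because at most one
group of spacers is inserted at each of the steps `j, …, j + L - 1`. -/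
theorem offset_succ_bounds (hr : ∀ j, 0 < D.r j) {s₀ : ℕ} (hs : ∀ j, ∀ i < D.r j, D.s j i ≤ s₀)
    (L j : ℕ) {i : ℕ} (hi : i + 1 < D.copies L j) :
    D.offset L j i + D.floors j ≤ D.offset L j (i + 1) ∧
      D.offset L j (i + 1) ≤ D.offset L j i + D.floors j + s₀ * L := by
  induction L generalizing j i with
  | zero => simp [copies] at hi
  | succ L ih =>
    have hmod := Nat.mod_lt i (hr j)
    have hdiv := Nat.div_add_mod i (D.r j)
    have hs' := hs j _ hmod
    have hsucc := D.colOffset_succ j (i % D.r j)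
    rcases Nat.lt_or_ge (i % D.r j + 1) (D.r j) with h | h
    · have h1 : (i + 1) / D.r j = i / D.r j := by
        rw [← hdiv, add_assoc, Nat.mul_add_div (hr j), Nat.div_eq_of_lt h, hdiv, add_zero]
      have h2 : (i + 1) % D.r j = i % D.r j + 1 := by
        conv_lhs => rw [← hdiv, add_assoc, Nat.mul_add_mod, Nat.mod_eq_of_lt h]
      rw [offset, offset, h1, h2, hsucc, mul_add, mul_one]
      constructor <;> omega
    · have h0 : i % D.r j + 1 = D.r j := le_antisymm hmod h
      have h3 : i + 1 = D.r j * (i / D.r j + 1) := by rw [mul_add, mul_one]; omega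
      have h1 : (i + 1) / D.r j = i / D.r j + 1 := by rw [h3, Nat.mul_div_cancel_left _ (hr j)]
      have h2 : (i + 1) % D.r j = 0 := by rw [h3, Nat.mul_mod_right]
      have h4 := ih (j + 1) (i := i / D.r j)
        (Nat.lt_of_mul_lt_mul_left (a := D.r j) (by rw [← h3]; exact hi))
      rw [h0, colOffset_r] at hsucc
      rw [offset, offset, h1, h2, colOffset_zero, mul_add, mul_one]
      constructor <;> omega

theorem offset_add_bounds (hr : ∀ j, 0 < D.r j) {s₀ : ℕ} (hs : ∀ j, ∀ i < D.r j, D.s j i ≤ s₀)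
    (L j : ℕ) {i : ℕ} (k : ℕ) (hi : i + k < D.copies L j) :
    D.offset L j i + k * D.floors j ≤ D.offset L j (i + k) ∧
      D.offset L j (i + k) ≤ D.offset L j i + k * D.floors j + k * (s₀ * L) := by
  induction k with
  | zero => simp
  | succ k ih =>
    have h1 := ih (by omega)
    have h2 := D.offset_succ_bounds hr hs L j (i := i + k) hi
    rw [← add_assoc, add_mul, add_mul, one_mul, one_mul]
    constructor <;> omega

end RankOneData

/-! ### Towers and approximate return times -/

theorem MeasurableEquiv.image_iterate_eq_preimage (T : X ≃ᵐ X) (k : ℕ) (A : Set X) :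
    T^[k] '' A = T.symm^[k] ⁻¹' A :=
  congrFun (image_eq_preimage_of_inverse (Function.LeftInverse.iterate T.symm_apply_apply k)
    (Function.RightInverse.iterate T.apply_symm_apply k)) A

theorem MeasurableEquiv.measurableSet_image_iterate (T : X ≃ᵐ X) (k : ℕ) {A : Set X}
    (hA : MeasurableSet A) : MeasurableSet (T^[k] '' A) := by
  rw [T.image_iterate_eq_preimage]
  exact T.symm.measurable.iterate k hA

theorem MeasureTheory.MeasurePreserving.measure_image_iterate {T : X ≃ᵐ X} {μ : Measure X}
    (hT : MeasurePreserving T μ μ) (k : ℕ) {A : Set X} (hA : MeasurableSet A) :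
    μ (T^[k] '' A) = μ A := by
  rw [← (hT.iterate k).measure_preimage (T.measurableSet_image_iterate k hA).nullMeasurableSet,
    preimage_image_eq _ (T.injective.iterate k)]

theorem MeasureTheory.MeasurePreserving.measureReal_image_iterate {T : X ≃ᵐ X} {μ : Measure X}
    (hT : MeasurePreserving T μ μ) (k : ℕ) {A : Set X} (hA : MeasurableSet A) :
    μ.real (T^[k] '' A) = μ.real A :=
  congrArg ENNReal.toReal (hT.measure_image_iterate k hA)

/-- The union of the first `H` floors over `b`. -/
def towerOver (T : X → X) (H : ℕ) (b : Set X) : Set X := ⋃ i ∈ Finset.range H, T^[i] '' b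

/-- The points of the tower of height `H` over `b` whose base point returns to `b` at time
`k * H + m`. For small `m` this means that it passes `m` spacers before the `k`-th return. -/
def returnSet (T : X → X) (H : ℕ) (b : Set X) (k m : ℕ) : Set X :=
  towerOver T H (b ∩ T^[k * H + m] ⁻¹' b)

theorem measurableSet_towerOver (T : X ≃ᵐ X) (H : ℕ) {b : Set X} (hb : MeasurableSet b) :
    MeasurableSet (towerOver T H b) :=
  Finset.measurableSet_biUnion _ fun i _ => T.measurableSet_image_iterate i hb

theorem measurableSet_returnSet (T : X ≃ᵐ X) (H : ℕ) {b : Set X} (hb : MeasurableSet b)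
    (k m : ℕ) : MeasurableSet (returnSet T H b k m) :=
  measurableSet_towerOver T H (hb.inter (T.measurable.iterate _ hb))

theorem measure_towerOver_le {T : X ≃ᵐ X} {μ : Measure X} [IsFiniteMeasure μ]
    (hT : MeasurePreserving T μ μ) (H : ℕ) {b : Set X} (hb : MeasurableSet b) :
    μ.real (towerOver T H b) ≤ H * μ.real b := by
  refine (measureReal_biUnion_finset_le _ _).trans_eq ?_
  simp [hT.measureReal_image_iterate _ hb]

theorem measure_towerOver {T : X ≃ᵐ X} {μ : Measure X} [IsFiniteMeasure μ]
    (hT : MeasurePreserving T μ μ) {H : ℕ} {b : Set X} (hb : MeasurableSet b)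
    (hd : {k : ℕ | k < H}.PairwiseDisjoint fun k => T^[k] '' b) :
    μ.real (towerOver T H b) = H * μ.real b := by
  rw [towerOver, measureReal_biUnion_finset
    (fun i hi j hj h => hd (Finset.mem_range.1 hi) (Finset.mem_range.1 hj) h)
    fun i _ => T.measurableSet_image_iterate i hb]
  simp [hT.measureReal_image_iterate _ hb]

theorem measure_preimage_symmDiff_towerOver_le {T : X ≃ᵐ X} {μ : Measure X} [IsFiniteMeasure μ]
    (hT : MeasurePreserving T μ μ) (H : ℕ) {b : Set X} (hb : MeasurableSet b) (p : ℕ) :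
    μ.real ((T^[p] ⁻¹' towerOver T H b) ∆ towerOver T H b) ≤ p * (2 * μ.real b) := by
  have hsub : (T ⁻¹' towerOver T H b) ∆ towerOver T H b ⊆ T ⁻¹' b ∪ T^[H - 1] '' b := by
    rintro x (⟨h1, h2⟩ | ⟨h1, h2⟩)
    · simp only [towerOver, Finset.mem_range, mem_preimage, mem_iUnion, exists_prop] at h1 h2
      obtain ⟨_ | i, hi, y, hy, hxy⟩ := h1
      · left
        rwa [mem_preimage, ← hxy]
      · refine absurd ⟨i, by omega, y, hy, T.injective ?_⟩ h2
        rw [← hxy, Function.iterate_succ_apply']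
    · simp only [towerOver, Finset.mem_range, mem_preimage, mem_iUnion, exists_prop] at h1 h2
      obtain ⟨i, hi, y, hy, hxy⟩ := h1
      right
      by_cases hiH : i + 1 < H
      · exact absurd ⟨i + 1, hiH, y, hy, by rw [Function.iterate_succ_apply', hxy]⟩ h2
      · obtain rfl : i = H - 1 := by omega
        exact ⟨y, hy, hxy⟩
  have h1 : μ.real (towerOver T H b ∆ (T ⁻¹' towerOver T H b)) ≤ 2 * μ.real b := by
    rw [symmDiff_comm]
    refine (measureReal_mono hsub).trans ((measureReal_union_le _ _).trans_eq ?_)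
    rw [hT.measureReal_image_iterate _ hb, Measure.real,
      hT.measure_preimage hb.nullMeasurableSet, ← Measure.real]
    ring
  have h2 := hT.measure_symmDiff_preimage_iterate_le
    (measurableSet_towerOver T H hb).nullMeasurableSet p
  rw [symmDiff_comm]
  rw [nsmul_eq_mul] at h2
  have h3 := ENNReal.toReal_mono
    (ENNReal.mul_ne_top (ENNReal.natCast_ne_top p) (measure_ne_top μ _)) h2
  rw [ENNReal.toReal_mul, ENNReal.toReal_natCast] at h3
  exact h3.trans (mul_le_mul_of_nonneg_left h1 (Nat.cast_nonneg p))

/-- A union of floors cannot tell a point of the return set from its image at the return time. -/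
theorem inter_returnSet_eq {T : X ≃ᵐ X} {H : ℕ} {b : Set X}
    (hd : {k : ℕ | k < H}.PairwiseDisjoint fun k => T^[k] '' b) {F : Finset ℕ}
    (hF : F ⊆ Finset.range H) (k m : ℕ) :
    (⋃ i ∈ F, T^[i] '' b) ∩ returnSet T H b k m =
      (T^[k * H + m] ⁻¹' ⋃ i ∈ F, T^[i] '' b) ∩ returnSet T H b k m := by
  ext x
  refine and_congr_left fun hx => ?_
  simp only [returnSet, towerOver, Finset.mem_range, mem_iUnion, exists_prop] at hx
  obtain ⟨i, hi, y, ⟨hy, hy'⟩, rfl⟩ := hx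
  have key : ∀ z ∈ b, T^[i] z ∈ (⋃ i ∈ F, T^[i] '' b) ↔ i ∈ F := by
    intro z hz
    simp only [mem_iUnion, exists_prop]
    refine ⟨fun ⟨i', hi', hz'⟩ => ?_, fun h => ⟨i, h, z, hz, rfl⟩⟩
    by_contra hne
    have hii : i' ≠ i := fun h => hne (h ▸ hi')
    exact disjoint_left.1 (hd (Finset.mem_range.1 (hF hi')) hi hii) hz' ⟨z, hz, rfl⟩
  rw [key y hy, mem_preimage, ← Function.iterate_add_apply, add_comm, Function.iterate_add_apply,
    key _ hy']

namespace IsCuttingStacking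

variable {D : RankOneData} {T : X ≃ᵐ X} {μ : Measure X} {E : ℕ → Set X} {C : ℕ → ℕ → Set X}

theorem column_eq (h : IsCuttingStacking D T μ E C) {j c : ℕ} (hc : c < D.r j) :
    C j c = T^[D.colOffset j c] '' E (j + 1) := by
  induction c with
  | zero => simp [h.next_base]
  | succ c ih =>
    rw [← h.stack j c hc, ih (by omega), ← image_comp, ← Function.iterate_add, D.colOffset_succ,
      add_comm]

theorem base_eq (h : IsCuttingStacking D T μ E C) (j : ℕ) :
    E j = ⋃ c ∈ Finset.range (D.r j), T^[D.colOffset j c] '' E (j + 1) := by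
  rw [h.cut j]
  exact iUnion₂_congr fun c hc => h.column_eq (Finset.mem_range.1 hc)

theorem base_eq_iUnion_offset (h : IsCuttingStacking D T μ E C) (hr : ∀ j, 0 < D.r j)
    (L j : ℕ) :
    E j = ⋃ i ∈ Finset.range (D.copies L j), T^[D.offset L j i] '' E (j + L) := by
  induction L generalizing j with
  | zero => simp [RankOneData.copies, RankOneData.offset]
  | succ L ih =>
    ext x
    rw [h.base_eq j, ih (j + 1)]
    simp only [Finset.mem_range, mem_iUnion, exists_prop, RankOneData.offset]
    rw [show j + 1 + L = j + (L + 1) by omega]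
    constructor
    · rintro ⟨c, hc, y, hy, rfl⟩
      simp only [mem_iUnion, exists_prop] at hy
      obtain ⟨i, hi, z, hz, rfl⟩ := hy
      refine ⟨D.r j * i + c, ?_, z, hz, ?_⟩
      · calc D.r j * i + c < D.r j * (i + 1) := by rw [mul_add, mul_one]; omega
          _ ≤ D.r j * D.copies L (j + 1) := Nat.mul_le_mul_left _ hi
      · rw [Nat.mul_add_div (hr j), Nat.mul_add_mod, Nat.div_eq_of_lt hc, Nat.mod_eq_of_lt hc,
          add_zero, ← Function.iterate_add_apply, add_comm]
    · rintro ⟨i, hi, z, hz, rfl⟩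
      refine ⟨i % D.r j, Nat.mod_lt _ (hr j), T^[D.offset L (j + 1) (i / D.r j)] z, ?_, ?_⟩
      · simp only [mem_iUnion, exists_prop]
        exact ⟨_, Nat.div_lt_of_lt_mul hi, z, hz, rfl⟩
      · rw [← Function.iterate_add_apply, add_comm]

theorem image_offset_subset (h : IsCuttingStacking D T μ E C) (hr : ∀ j, 0 < D.r j)
    (L j : ℕ) {i : ℕ} (hi : i < D.copies L j) : T^[D.offset L j i] '' E (j + L) ⊆ E j := by
  conv_rhs => rw [h.base_eq_iUnion_offset hr L j]
  exact subset_iUnion₂_of_subset i (Finset.mem_range.2 hi) subset_rfl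

theorem measure_base (h : IsCuttingStacking D T μ E C) (hr : ∀ j, 0 < D.r j) (L j : ℕ) :
    μ.real (E j) = D.copies L j * μ.real (E (j + L)) := by
  induction L generalizing j with
  | zero => simp [RankOneData.copies]
  | succ L ih =>
    have h1 := congrArg ENNReal.toReal (h.measure_cut j 0 (hr j))
    rw [← h.next_base, ENNReal.toReal_div, ENNReal.toReal_natCast] at h1
    have h2 : μ.real (E (j + 1)) = μ.real (E j) / D.r j := h1
    have hr' : (D.r j : ℝ) ≠ 0 := Nat.cast_ne_zero.2 (hr j).ne'
    rw [ih (j + 1), show j + 1 + L = j + (L + 1) by omega] at h2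
    rw [RankOneData.copies, Nat.cast_mul, mul_assoc, h2, mul_div_cancel₀ _ hr']

/-- A union of floors of one tower is a union of floors of each later tower. -/
theorem exists_floors_eq (h : IsCuttingStacking D T μ E C) {i j : ℕ} (hij : i ≤ j)
    {F : Finset ℕ} (hF : F ⊆ Finset.range (D.floors i)) :
    ∃ F' ⊆ Finset.range (D.floors j), ⋃ k ∈ F, T^[k] '' E i = ⋃ k ∈ F', T^[k] '' E j := by
  classical
  induction j, hij using Nat.le_induction with
  | base => exact ⟨F, hF, rfl⟩
  | succ j hij ih =>
    obtain ⟨F', hF', heq⟩ := ih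
    refine ⟨(F' ×ˢ Finset.range (D.r j)).image fun x => x.1 + D.colOffset j x.2, ?_, ?_⟩
    · intro k hk
      simp only [Finset.mem_image, Finset.mem_product, Finset.mem_range] at hk ⊢
      obtain ⟨x, ⟨hx1, hx2⟩, rfl⟩ := hk
      exact D.add_colOffset_lt (Finset.mem_range.1 (hF' hx1)) hx2
    · rw [heq, Finset.set_biUnion_finset_image, h.base_eq j]
      ext x
      simp only [mem_iUnion, exists_prop, mem_image, Finset.mem_product, Finset.mem_range]
      constructor
      · rintro ⟨k, hk, y, ⟨c, hc, z, hz, rfl⟩, rfl⟩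
        exact ⟨(k, c), ⟨hk, hc⟩, z, hz, Function.iterate_add_apply _ _ _ _⟩
      · rintro ⟨⟨k, c⟩, ⟨hk, hc⟩, z, hz, rfl⟩
        exact ⟨k, hk, _, ⟨c, hc, z, hz, rfl⟩, (Function.iterate_add_apply _ _ _ _).symm⟩

theorem monotone_tower (h : IsCuttingStacking D T μ E C) :
    Monotone fun j => towerOver T (D.floors j) (E j) := by
  intro i j hij
  obtain ⟨F, hF, heq⟩ := h.exists_floors_eq hij (Finset.Subset.refl _)
  change (⋃ k ∈ _, _) ⊆ ⋃ k ∈ _, _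
  rw [heq]
  exact biUnion_subset_biUnion_left hF

variable [IsProbabilityMeasure μ]

theorem measure_tower (h : IsCuttingStacking D T μ E C) (hT : MeasurePreserving T μ μ) (j : ℕ) :
    μ.real (towerOver T (D.floors j) (E j)) = D.floors j * μ.real (E j) :=
  measure_towerOver hT (h.measurableSet_base j) (h.disjoint_floors j)

theorem tendsto_measure_tower (h : IsCuttingStacking D T μ E C) (hT : MeasurePreserving T μ μ) :
    Tendsto (fun j => (D.floors j : ℝ) * μ.real (E j)) atTop (𝓝 1) := by
  have h1 := tendsto_measure_iUnion_atTop (μ := μ) h.monotone_tower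
  have hm : MeasurableSet (⋃ j, towerOver T (D.floors j) (E j)) :=
    .iUnion fun j => measurableSet_towerOver T _ (h.measurableSet_base j)
  rw [(prob_compl_eq_zero_iff hm).1 h.exhaust] at h1
  have h2 := (ENNReal.tendsto_toReal ENNReal.one_ne_top).comp h1
  rw [ENNReal.toReal_one] at h2
  exact h2.congr fun j => h.measure_tower hT j

theorem measure_base_pos (h : IsCuttingStacking D T μ E C) (hT : MeasurePreserving T μ μ)
    (hr : ∀ j, 0 < D.r j) (j : ℕ) : 0 < μ.real (E j) := by
  obtain ⟨L, hL⟩ := (((h.tendsto_measure_tower hT).comp (tendsto_add_atTop_nat j)).eventually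
    (lt_mem_nhds zero_lt_one)).exists
  rw [h.measure_base hr L j]
  refine mul_pos (Nat.cast_pos.2 (D.copies_pos hr L j)) ?_
  rw [add_comm j L]
  exact pos_of_mul_pos_right hL (Nat.cast_nonneg _)

theorem tendsto_measure_base (h : IsCuttingStacking D T μ E C) (hr : ∀ j, 2 < D.r j) :
    Tendsto (fun j => μ.real (E j)) atTop (𝓝 0) := by
  refine squeeze_zero (fun j => measureReal_nonneg) (fun j => ?_)
    (tendsto_pow_atTop_nhds_zero_of_lt_one (r := (3 : ℝ)⁻¹) (by norm_num) (by norm_num))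
  have h1 := h.measure_base (fun j => (Nat.zero_le 2).trans_lt (hr j)) j 0
  rw [zero_add] at h1
  have h2 : μ.real (E 0) ≤ 1 := measureReal_le_one
  have h3 : (3 : ℝ) ^ j ≤ D.copies j 0 := by exact_mod_cast D.three_pow_le_copies hr j 0
  rw [inv_pow, ← one_div, le_div_iff₀ (by positivity), mul_comm]
  exact (mul_le_mul_of_nonneg_right h3 measureReal_nonneg).trans (h1 ▸ h2)

end IsCuttingStacking

/-! ### Return times seen by a joining -/

theorem preimage_iterate_add {α : Type*} (f : α → α) (m n : ℕ) (A : Set α) :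
    f^[m + n] ⁻¹' A = f^[m] ⁻¹' (f^[n] ⁻¹' A) := by
  rw [add_comm, Function.iterate_add, preimage_comp]

theorem preimage_iterate_mul_eq {T : X → X} (hT : Measurable T) {p q : ℕ}
    {β : Set X → Set X → ℝ} (hinv : ∀ A B, MeasurableSet A → MeasurableSet B →
      β (T^[p] ⁻¹' A) (T^[q] ⁻¹' B) = β A B) (c : ℕ) {A B : Set X} (hA : MeasurableSet A)
    (hB : MeasurableSet B) : β (T^[c * p] ⁻¹' A) (T^[c * q] ⁻¹' B) = β A B := by
  induction c with
  | zero => simp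
  | succ c ih =>
    rw [add_mul, add_mul, one_mul, one_mul, add_comm, preimage_iterate_add, add_comm _ q,
      preimage_iterate_add, hinv _ _ (hT.iterate _ hA) (hT.iterate _ hB), ih]

namespace IsJoiningForm

/-- A joining form that has a second invariance, independent of the defining one, is invariant
under a power of `T` in the first variable alone. Total ergodicity makes it the product. -/
theorem eq_mul_of_preimage_eq {μ : Measure X} [IsProbabilityMeasure μ] {T : X → X}
    (hT : Measurable T) (hTe : ∀ k, 0 < k → Ergodic T^[k] μ) {p q : ℕ} {β : Set X → Set X → ℝ}
    (h : IsJoiningForm μ T^[p] T^[q] β) {m n : ℕ} (hmn : q * m ≠ p * n)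
    (hinv : ∀ A B, MeasurableSet A → MeasurableSet B →
      β (T^[m] ⁻¹' A) (T^[n] ⁻¹' B) = β A B) {A B : Set X} (hA : MeasurableSet A)
    (hB : MeasurableSet B) : β A B = μ.real A * μ.real B := by
  have h1 : ∀ A, MeasurableSet A → β (T^[q * m] ⁻¹' A) (T^[q * n] ⁻¹' B) = β A B :=
    fun A hA => preimage_iterate_mul_eq hT hinv q hA hB
  have h2 : ∀ A, MeasurableSet A → β (T^[p * n] ⁻¹' A) (T^[q * n] ⁻¹' B) = β A B := by
    intro A hA
    rw [mul_comm p, mul_comm q]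
    exact preimage_iterate_mul_eq hT h.preimage n hA hB
  obtain ⟨k, hk, hkinv⟩ : ∃ k, 0 < k ∧ ∀ A, MeasurableSet A → β (T^[k] ⁻¹' A) B = β A B := by
    rcases hmn.lt_or_gt with hlt | hlt
    · refine ⟨p * n - q * m, by omega, fun A hA => ?_⟩
      rw [← h1 _ (hT.iterate _ hA), ← preimage_iterate_add, Nat.add_sub_cancel' hlt.le, h2 A hA]
    · refine ⟨q * m - p * n, by omega, fun A hA => ?_⟩
      rw [← h2 _ (hT.iterate _ hA), ← preimage_iterate_add, Nat.add_sub_cancel' hlt.le, h1 A hA]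
  have := (hTe k hk).eq_mul_of_le_measure (l := fun A => β A B)
    (fun A A' hA hA' hd => h.union_left _ _ _ hA hA' hB hd) (fun A _ => h.nonneg A B)
    (fun A hA => h.le_left hA hB) hkinv hA
  rw [this, h.univ_left B hB, mul_comm]

theorem biUnion_range_le {μ : Measure X} {S U : X → X} {β : Set X → Set X → ℝ}
    (h : IsJoiningForm μ S U β) {A : ℕ → Set X} (hA : ∀ i, MeasurableSet (A i)) {B : Set X}
    (hB : MeasurableSet B) (n : ℕ) :
    β (⋃ i ∈ Finset.range n, A i) B ≤ ∑ i ∈ Finset.range n, β (A i) B := by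
  induction n with
  | zero =>
    have := h.union_left ∅ ∅ B .empty .empty hB (disjoint_empty _)
    rw [union_self] at this
    simp only [Finset.range_zero, Finset.notMem_empty, iUnion_of_empty, iUnion_empty,
      Finset.sum_empty]
    linarith
  | succ n ih =>
    have hm : MeasurableSet (⋃ i ∈ Finset.range n, A i) :=
      Finset.measurableSet_biUnion _ fun i _ => hA i
    rw [Finset.range_add_one, Finset.set_biUnion_insert, Finset.sum_insert Finset.notMem_range_self,
      ← union_sdiff_self, h.union_left _ _ _ (hA n) (hm.diff (hA n)) hB disjoint_sdiff_right]
    exact add_le_add le_rfl ((h.mono (hm.diff (hA n)) hm hB hB sdiff_subset subset_rfl).trans ih)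

end IsJoiningForm

namespace IsCuttingStacking

variable {D : RankOneData} {T : X ≃ᵐ X} {μ : Measure X} [IsProbabilityMeasure μ] {E : ℕ → Set X}
  {C : ℕ → ℕ → Set X}

theorem tendsto_symmDiff_returnSet (h : IsCuttingStacking D T μ E C)
    (hT : MeasurePreserving T μ μ) (hr : ∀ j, 2 < D.r j) (p k m : ℕ) :
    Tendsto (fun j => μ.real ((T^[p] ⁻¹' returnSet T (D.floors j) (E j) k m) ∆
      returnSet T (D.floors j) (E j) k m)) atTop (𝓝 0) := by
  have h1 := ((h.tendsto_measure_base hr).const_mul 2).const_mul (p : ℝ)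
  simp only [mul_zero] at h1
  refine squeeze_zero (fun j => measureReal_nonneg) (fun j => ?_) h1
  refine (measure_preimage_symmDiff_towerOver_le hT _
    ((h.measurableSet_base j).inter (T.measurable.iterate _ (h.measurableSet_base j))) p).trans ?_
  gcongr
  exacts [measure_ne_top _ _, inter_subset_left]

theorem tendsto_symmDiff_image_returnSet (h : IsCuttingStacking D T μ E C)
    (hT : MeasurePreserving T μ μ) (hr : ∀ j, 2 < D.r j) (p k m : ℕ) (N : ℕ → ℕ) :
    Tendsto (fun j => μ.real ((T^[p] ⁻¹' (T^[N j] '' returnSet T (D.floors j) (E j) k m)) ∆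
      (T^[N j] '' returnSet T (D.floors j) (E j) k m))) atTop (𝓝 0) := by
  refine (h.tendsto_symmDiff_returnSet hT hr p k m).congr fun j => ?_
  have hm := measurableSet_returnSet T (D.floors j) (h.measurableSet_base j) k m
  have hm' := T.measurableSet_image_iterate (N j) hm
  rw [measureReal_def, measureReal_def, ← (hT.iterate (N j)).measure_preimage
    ((T.measurable.iterate p hm').symmDiff hm').nullMeasurableSet, preimage_symmDiff,
    ← preimage_iterate_add, add_comm, preimage_iterate_add,
    preimage_image_eq _ (T.injective.iterate (N j))]

/-- A second invariance of a joining form only has to be checked on unions of floors of one tower,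
because these approximate all measurable sets and the form is continuous with respect to `μ`. -/
theorem preimage_eq_of_floors (h : IsCuttingStacking D T μ E C) (hT : MeasurePreserving T μ μ)
    {S U : X → X} {β : Set X → Set X → ℝ} (hβ : IsJoiningForm μ S U β) {m n : ℕ}
    (hinv : ∀ j, ∀ F ⊆ Finset.range (D.floors j), ∀ G ⊆ Finset.range (D.floors j),
      β (T^[m] ⁻¹' ⋃ k ∈ F, T^[k] '' E j) (T^[n] ⁻¹' ⋃ k ∈ G, T^[k] '' E j) =
        β (⋃ k ∈ F, T^[k] '' E j) (⋃ k ∈ G, T^[k] '' E j)) {A B : Set X}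
    (hA : MeasurableSet A) (hB : MeasurableSet B) :
    β (T^[m] ⁻¹' A) (T^[n] ⁻¹' B) = β A B := by
  refine eq_of_forall_dist_le fun ε hε => ?_
  have happ : ∀ A, MeasurableSet A → ∃ j, ∃ F ⊆ Finset.range (D.floors j),
      μ.real (A ∆ ⋃ k ∈ F, T^[k] '' E j) ≤ ε / 4 := by
    intro A hA
    obtain ⟨j, F, hF, hlt⟩ := h.generate A hA (ENNReal.ofReal (ε / 4))
      (ENNReal.ofReal_pos.2 (by positivity))
    exact ⟨j, F, hF, ENNReal.toReal_le_of_le_ofReal (by positivity) hlt.le⟩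
  obtain ⟨i, F, hF, hAF⟩ := happ A hA
  obtain ⟨i', G, hG, hBG⟩ := happ B hB
  obtain ⟨F', hF', hFF⟩ := h.exists_floors_eq (le_max_left i i') hF
  obtain ⟨G', hG', hGG⟩ := h.exists_floors_eq (le_max_right i i') hG
  rw [hFF] at hAF
  rw [hGG] at hBG
  have hm : ∀ F : Finset ℕ, MeasurableSet (⋃ k ∈ F, T^[k] '' E (max i i')) := fun F =>
    Finset.measurableSet_biUnion _ fun k _ =>
      T.measurableSet_image_iterate k (h.measurableSet_base _)
  have hpre : ∀ (N : ℕ) (A B : Set X), MeasurableSet A → MeasurableSet B →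
      μ.real ((T^[N] ⁻¹' A) ∆ (T^[N] ⁻¹' B)) = μ.real (A ∆ B) := by
    intro N A B hA hB
    rw [measureReal_def, measureReal_def, ← preimage_symmDiff,
      (hT.iterate N).measure_preimage (hA.symmDiff hB).nullMeasurableSet]
  have h1 := hβ.abs_sub_le hA (hm F') hB (hm G')
  have h2 := hβ.abs_sub_le (T.measurable.iterate m hA) (T.measurable.iterate m (hm F'))
    (T.measurable.iterate n hB) (T.measurable.iterate n (hm G'))
  rw [hpre m _ _ hA (hm F'), hpre n _ _ hB (hm G'), hinv _ F' hF' G' hG'] at h2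
  rw [abs_le] at h1 h2
  rw [Real.dist_eq, abs_le]
  constructor <;> linarith [h1.1, h1.2, h2.1, h2.2]

/-- If an extreme joining form of `T^[p]` and `T^[q]` is not the product, then asymptotically
almost all pairs `(x, y)` pass numbers of spacers in the proportion `p : q` during the time
`t * D.floors j` of `T^[p] × T^[q]`. Otherwise, comparing the restrictions of the form to the
return sets and to their images under the return, which look alike up to a bounded shift,
yields a second invariance. -/
theorem tendsto_form_returnSet (h : IsCuttingStacking D T μ E C) (hT : MeasurePreserving T μ μ)
    (hr : ∀ j, 2 < D.r j) (hTe : ∀ k, 0 < k → Ergodic T^[k] μ) {p q : ℕ} (hp : 0 < p) (hq : 0 < q)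
    {β : Set X → Set X → ℝ} (hβ : β ∈ extremePoints ℝ {β | IsJoiningForm μ T^[p] T^[q] β})
    (hprod : ∃ A B, MeasurableSet A ∧ MeasurableSet B ∧ β A B ≠ μ.real A * μ.real B)
    (t : ℕ) {m n : ℕ} (hmn : q * m ≠ p * n) :
    Tendsto (fun j => β (returnSet T (D.floors j) (E j) (t * p) m)
      (returnSet T (D.floors j) (E j) (t * q) n)) atTop (𝓝 0) := by
  have hβ' : IsJoiningForm μ T^[p] T^[q] β := hβ.1
  rw [tendsto_iff_ultrafilter]
  intro l hl
  set P : ℕ → Set X := fun j => returnSet T (D.floors j) (E j) (t * p) m with hPdef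
  set Q : ℕ → Set X := fun j => returnSet T (D.floors j) (E j) (t * q) n with hQdef
  set P' : ℕ → Set X := fun j => T^[t * D.floors j * p] '' P j with hP'def
  set Q' : ℕ → Set X := fun j => T^[t * D.floors j * q] '' Q j with hQ'def
  have hP : ∀ j, MeasurableSet (P j) := fun j =>
    measurableSet_returnSet T _ (h.measurableSet_base j) _ _
  have hQ : ∀ j, MeasurableSet (Q j) := fun j =>
    measurableSet_returnSet T _ (h.measurableSet_base j) _ _
  have hP' : ∀ j, MeasurableSet (P' j) := fun j => T.measurableSet_image_iterate _ (hP j)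
  have hQ' : ∀ j, MeasurableSet (Q' j) := fun j => T.measurableSet_image_iterate _ (hQ j)
  have hPP : ∀ j, P j = T^[t * D.floors j * p] ⁻¹' P' j := fun j =>
    (preimage_image_eq _ (T.injective.iterate _)).symm
  have hQQ : ∀ j, Q j = T^[t * D.floors j * q] ⁻¹' Q' j := fun j =>
    (preimage_image_eq _ (T.injective.iterate _)).symm
  obtain ⟨c, hc⟩ := exists_tendsto_inter_of_extreme (hTe p hp) (hTe q hq) hβ l hP hQ
    ((h.tendsto_symmDiff_returnSet hT hr p _ m).mono_left hl)
    ((h.tendsto_symmDiff_returnSet hT hr q _ n).mono_left hl)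
  obtain ⟨c', hc'⟩ := exists_tendsto_inter_of_extreme (hTe p hp) (hTe q hq) hβ l hP' hQ'
    ((h.tendsto_symmDiff_image_returnSet hT hr p _ m _).mono_left hl)
    ((h.tendsto_symmDiff_image_returnSet hT hr q _ n _).mono_left hl)
  have huniv : β univ univ = 1 := by simp [hβ'.univ_left univ .univ]
  have hshift : ∀ j A B, MeasurableSet A → MeasurableSet B →
      β (T^[t * D.floors j * p] ⁻¹' A) (T^[t * D.floors j * q] ⁻¹' B) = β A B :=
    fun j A B hA hB => preimage_iterate_mul_eq T.measurable hβ'.preimage _ hA hB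
  have hc1 := hc univ univ .univ .univ
  have hc1' := hc' univ univ .univ .univ
  simp only [univ_inter, huniv, mul_one] at hc1 hc1'
  have hcc : c = c' := tendsto_nhds_unique hc1 (hc1'.congr fun j => by
    rw [hPP j, hQQ j, hshift j _ _ (hP' j) (hQ' j)])
  -- Only the case of a positive limit is left; it leads to invariance under `T^[m] × T^[n]`.
  by_cases hc0 : c = 0
  · rwa [hc0] at hc1
  exfalso
  obtain ⟨A, B, hA, hB, hAB⟩ := hprod
  refine hAB (hβ'.eq_mul_of_preimage_eq T.measurable hTe hmn ?_ hA hB)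
  intro A B hA hB
  refine h.preimage_eq_of_floors hT hβ' ?_ hA hB
  intro i F hF G hG
  have hm : ∀ F : Finset ℕ, MeasurableSet (⋃ k ∈ F, T^[k] '' E i) := fun F =>
    Finset.measurableSet_biUnion _ fun k _ =>
      T.measurableSet_image_iterate k (h.measurableSet_base _)
  have h1 := hc _ _ (hm F) (hm G)
  have h2 := hc' _ _ (T.measurable.iterate m (hm F)) (T.measurable.iterate n (hm G))
  have h3 : ∀ᶠ j in (l : Filter ℕ), β ((T^[m] ⁻¹' ⋃ k ∈ F, T^[k] '' E i) ∩ P' j)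
      ((T^[n] ⁻¹' ⋃ k ∈ G, T^[k] '' E i) ∩ Q' j) =
      β ((⋃ k ∈ F, T^[k] '' E i) ∩ P j) ((⋃ k ∈ G, T^[k] '' E i) ∩ Q j) := by
    filter_upwards [hl (eventually_ge_atTop i)] with j hj
    have key : ∀ (F : Finset ℕ) (k m : ℕ), F ⊆ Finset.range (D.floors i) →
        (⋃ a ∈ F, T^[a] '' E i) ∩ returnSet T (D.floors j) (E j) (t * k) m =
          T^[t * D.floors j * k] ⁻¹' (T^[m] ⁻¹' ⋃ a ∈ F, T^[a] '' E i) ∩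
            returnSet T (D.floors j) (E j) (t * k) m := by
      intro F k m hF
      obtain ⟨F', hF', heq⟩ := h.exists_floors_eq hj hF
      rw [heq, inter_returnSet_eq (h.disjoint_floors j) hF', ← preimage_iterate_add,
        mul_right_comm t k]
    rw [← hshift j _ _ ((T.measurable.iterate m (hm F)).inter (hP' j))
      ((T.measurable.iterate n (hm G)).inter (hQ' j)), preimage_inter, preimage_inter, ← hPP,
      ← hQQ, ← key F p m hF, ← key G q n hG]
  have h4 := tendsto_nhds_unique (h2.congr' h3) h1
  rw [hcc] at h4
  exact mul_left_cancel₀ (hcc ▸ hc0) h4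

/-- The number of spacers passed before the `k`-th return is tight, uniformly in the step. -/
theorem exists_measure_biUnion_returnSet (h : IsCuttingStacking D T μ E C)
    (hT : MeasurePreserving T μ μ) (hr : ∀ j, 2 < D.r j) {s₀ : ℕ}
    (hs : ∀ j, ∀ i < D.r j, D.s j i ≤ s₀) (k : ℕ) {ε : ℝ} (hε : 0 < ε) :
    ∃ M, ∀ᶠ j in atTop,
      1 - ε ≤ μ.real (⋃ m ∈ Finset.range M, returnSet T (D.floors j) (E j) k m) := by
  have hr' : ∀ j, 0 < D.r j := fun j => (Nat.zero_le 2).trans_lt (hr j)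
  obtain ⟨L, hL⟩ := exists_nat_gt (k / (ε / 2))
  refine ⟨k * (s₀ * L) + 1, ?_⟩
  filter_upwards [(h.tendsto_measure_tower hT).eventually
    (le_mem_nhds (show 1 - ε / 2 < 1 by linarith))] with j hj
  set R := D.copies L j with hR
  set W : Set X := ⋃ m ∈ Finset.range (k * (s₀ * L) + 1), returnSet T (D.floors j) (E j) k m
  -- The last `k` copies of the base: from there the `k`-th return may leave the tower.
  set b : Set X := ⋃ i ∈ Finset.range k, T^[D.offset L j (R - 1 - i)] '' E (j + L) with hb
  have hbm : MeasurableSet b := Finset.measurableSet_biUnion _ fun i _ =>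
    T.measurableSet_image_iterate _ (h.measurableSet_base _)
  have hsub : towerOver T (D.floors j) (E j) ⊆ W ∪ towerOver T (D.floors j) b := by
    intro x hx
    simp only [towerOver, mem_iUnion, exists_prop] at hx
    obtain ⟨a, ha, y, hy, rfl⟩ := hx
    have hy' := hy
    rw [h.base_eq_iUnion_offset hr' L j] at hy'
    simp only [mem_iUnion, exists_prop, Finset.mem_range] at hy'
    obtain ⟨i, hi, z, hz, hzy⟩ := hy'
    rcases Nat.lt_or_ge (i + k) R with hik | hik
    · left
      obtain ⟨h1, h2⟩ := D.offset_add_bounds hr' hs L j k hik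
      obtain ⟨m, hm⟩ := Nat.exists_eq_add_of_le h1
      simp only [W, mem_iUnion, exists_prop, Finset.mem_range]
      refine ⟨m, by omega, ?_⟩
      simp only [returnSet, towerOver, mem_iUnion, exists_prop]
      refine ⟨a, ha, y, ⟨hy, h.image_offset_subset hr' L j hik ⟨z, hz, ?_⟩⟩, rfl⟩
      rw [← hzy, ← Function.iterate_add_apply, hm, add_assoc, add_comm]
    · right
      simp only [towerOver, mem_iUnion, exists_prop]
      refine ⟨a, ha, y, ?_, rfl⟩
      simp only [hb, mem_iUnion, exists_prop, Finset.mem_range]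
      exact ⟨R - 1 - i, by omega, z, hz, by rw [← hzy, show R - 1 - (R - 1 - i) = i by omega]⟩
  have h1 := (measureReal_mono (μ := μ) hsub).trans (measureReal_union_le _ _)
  rw [h.measure_tower hT] at h1
  have h2 := measure_towerOver_le hT (D.floors j) hbm
  have h3 : μ.real b ≤ k * μ.real (E (j + L)) := by
    refine (measureReal_biUnion_finset_le _ _).trans_eq ?_
    simp [hT.measureReal_image_iterate _ (h.measurableSet_base (j + L))]
  have h4 := h.measure_base hr' L j
  have h5 : (D.floors j : ℝ) * μ.real (E j) ≤ 1 := by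
    rw [← h.measure_tower hT]
    exact measureReal_le_one
  have hRL : (L : ℝ) < R := by
    exact_mod_cast (Nat.lt_pow_self (by norm_num : 1 < 3)).trans_le (D.three_pow_le_copies hr L j)
  have h6 : (k : ℝ) ≤ ε / 2 * R := by
    rw [div_lt_iff₀ (by positivity)] at hL
    nlinarith
  have h7 : (D.floors j : ℝ) * μ.real b ≤ ε / 2 := by
    calc (D.floors j : ℝ) * μ.real b ≤ D.floors j * (k * μ.real (E (j + L))) := by gcongr
      _ ≤ D.floors j * (ε / 2 * R * μ.real (E (j + L))) := by gcongr
      _ = ε / 2 * (D.floors j * μ.real (E j)) := by rw [h4]; ring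
      _ ≤ ε / 2 * 1 := by gcongr
      _ = ε / 2 := mul_one _
  linarith

/-- If the numbers of spacers passed by the two points of a pair are in the proportion `p : q`,
then those passed before the return number `u * (d * q' ^ k)` are divisible by `q' ^ k`. Indeed
`q' * n = p' * m` forces `q'` to divide `m`; since the two numbers of returns are also in the
proportion `p : q`, the divisibility of `n` by a power of `q'` passes on to `m`. -/
theorem tendsto_measure_returnSet_of_not_dvd (h : IsCuttingStacking D T μ E C)
    (hT : MeasurePreserving T μ μ) (hr : ∀ j, 2 < D.r j) {s₀ : ℕ}
    (hs : ∀ j, ∀ i < D.r j, D.s j i ≤ s₀) {d p' q' : ℕ} (hd : 0 < d) (hpq : Nat.Coprime p' q')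
    {S U : X → X} {β : Set X → Set X → ℝ} (hβ : IsJoiningForm μ S U β)
    (hrel : ∀ t m n, d * q' * m ≠ d * p' * n →
      Tendsto (fun j => β (returnSet T (D.floors j) (E j) (t * (d * p')) m)
        (returnSet T (D.floors j) (E j) (t * (d * q')) n)) atTop (𝓝 0))
    (k u : ℕ) {m : ℕ} (hm : ¬ q' ^ k ∣ m) :
    Tendsto (fun j => μ.real (returnSet T (D.floors j) (E j) (u * (d * q' ^ k)) m)) atTop
      (𝓝 0) := by
  induction k generalizing u m with
  | zero => exact absurd (by simp) hm
  | succ k ih =>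
    have e1 : u * (d * q' ^ (k + 1)) = u * q' ^ k * (d * q') := by ring
    rw [e1]
    set t := u * q' ^ k with ht
    have hRm : ∀ j k m, MeasurableSet (returnSet T (D.floors j) (E j) k m) := fun j k m =>
      measurableSet_returnSet T _ (h.measurableSet_base j) k m
    have hzero : ∀ n, Tendsto (fun j => β (returnSet T (D.floors j) (E j) (t * (d * p')) n)
        (returnSet T (D.floors j) (E j) (t * (d * q')) m)) atTop (𝓝 0) := by
      intro n
      by_cases hne : d * q' * n = d * p' * m
      · have hn : ¬ q' ^ k ∣ n := by
          intro hdvd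
          rw [mul_assoc, mul_assoc] at hne
          have h1 : q' * n = p' * m := Nat.eq_of_mul_eq_mul_left hd hne
          have h2 : q' ^ (k + 1) ∣ p' * m := by
            rw [← h1, pow_succ']
            exact Nat.mul_dvd_mul_left _ hdvd
          exact hm ((hpq.symm.pow_left (k + 1)).dvd_of_dvd_mul_left h2)
        have h3 := ih (u * p') hn
        rw [show u * p' * (d * q' ^ k) = t * (d * p') by rw [ht]; ring] at h3
        exact squeeze_zero (fun j => hβ.nonneg _ _)
          (fun j => hβ.le_left (hRm _ _ _) (hRm _ _ _)) h3
      · exact hrel t n m hne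
    rw [tendsto_order]
    refine ⟨fun a ha => .of_forall fun j => ha.trans_le measureReal_nonneg, fun ε hε => ?_⟩
    obtain ⟨M, hM⟩ := h.exists_measure_biUnion_returnSet hT hr hs (t * (d * p')) (half_pos hε)
    have hsum := tendsto_finsetSum (Finset.range M) fun n _ => hzero n
    rw [Finset.sum_const_zero] at hsum
    filter_upwards [hM, hsum.eventually (gt_mem_nhds (half_pos hε))] with j hj hj'
    set V := ⋃ n ∈ Finset.range M, returnSet T (D.floors j) (E j) (t * (d * p')) n with hV
    have hVm : MeasurableSet V := Finset.measurableSet_biUnion _ fun n _ => hRm _ _ _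
    have h1 := hβ.union_left V Vᶜ (returnSet T (D.floors j) (E j) (t * (d * q')) m) hVm hVm.compl
      (hRm _ _ _) disjoint_compl_right
    rw [union_compl_self, hβ.univ_left _ (hRm _ _ _)] at h1
    have h2 := hβ.biUnion_range_le (fun n => hRm j (t * (d * p')) n) (hRm j (t * (d * q')) m) M
    have h3 := hβ.le_left hVm.compl (hRm j (t * (d * q')) m)
    rw [probReal_compl_eq_one_sub hVm] at h3
    linarith

end IsCuttingStacking

/-! ### Constant spacers -/

namespace IsCuttingStacking

variable {D : RankOneData} {T : X ≃ᵐ X} {μ : Measure X} [IsProbabilityMeasure μ] {E : ℕ → Set X}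
  {C : ℕ → ℕ → Set X}

/-- A number of spacers that occurs between two copies of a tower inside a later tower is met
by a definite part of the space. -/
theorem le_measure_returnSet (h : IsCuttingStacking D T μ E C) (hT : MeasurePreserving T μ μ)
    (hr : ∀ j, 0 < D.r j) (L j : ℕ) {i k m : ℕ} (hik : i + k < D.copies L j)
    (hm : D.offset L j (i + k) = D.offset L j i + k * D.floors j + m) :
    D.floors j * μ.real (E j) ≤
      D.copies L j * μ.real (returnSet T (D.floors j) (E j) k m) := by
  set b := E j ∩ T^[k * D.floors j + m] ⁻¹' E j with hb
  have hbm : MeasurableSet b :=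
    (h.measurableSet_base j).inter (T.measurable.iterate _ (h.measurableSet_base j))
  have h1 : T^[D.offset L j i] '' E (j + L) ⊆ b := by
    rintro - ⟨z, hz, rfl⟩
    refine ⟨h.image_offset_subset hr L j (by omega) ⟨z, hz, rfl⟩, ?_⟩
    rw [mem_preimage, ← Function.iterate_add_apply]
    refine h.image_offset_subset hr L j hik ⟨z, hz, ?_⟩
    rw [hm, add_assoc, add_comm]
  have h2 := measureReal_mono (μ := μ) h1
  rw [hT.measureReal_image_iterate _ (h.measurableSet_base _)] at h2
  have h3 : μ.real (returnSet T (D.floors j) (E j) k m) = D.floors j * μ.real b :=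
    measure_towerOver hT hbm
      ((h.disjoint_floors j).mono fun i => image_mono inter_subset_left)
  rw [h3, h.measure_base hr L j]
  calc (D.floors j : ℝ) * (D.copies L j * μ.real (E (j + L)))
      = D.copies L j * (D.floors j * μ.real (E (j + L))) := by ring
    _ ≤ D.copies L j * (D.floors j * μ.real b) := by gcongr

/-- If, for all `k`, the numbers of spacers passed before the return number `d * q ^ k` are
asymptotically divisible by `q ^ k`, then each tower of a late step sees a constant number of
spacers between its successive copies in the tower two steps later. For `q ^ k` exceeding all the
numbers of spacers that occur in the tower `L + 2` steps later, with `L` proportional to `k`,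
divisibility makes the sequence of these numbers `d * q ^ k`-periodic. A copy of the tower `L` steps
later is longer than the period, so it determines the number of spacers that follows it. -/
theorem eventually_exists_offset_two_succ (h : IsCuttingStacking D T μ E C)
    (hT : MeasurePreserving T μ μ) (hr : ∀ j, 2 < D.r j) {r₀ s₀ : ℕ} (hr₀ : ∀ j, D.r j ≤ r₀)
    (hs : ∀ j, ∀ i < D.r j, D.s j i ≤ s₀) {d q : ℕ} (hd : 0 < d) (hq : 2 ≤ q)
    (hdvd : ∀ k m, ¬ q ^ k ∣ m →
      Tendsto (fun j => μ.real (returnSet T (D.floors j) (E j) (d * q ^ k) m)) atTop (𝓝 0)) :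
    ∀ᶠ j in atTop, ∃ K, ∀ c, c + 1 < D.copies 2 j → D.offset 2 j (c + 1) = D.offset 2 j c + K := by
  have hr' : ∀ j, 0 < D.r j := fun j => (Nat.zero_le 2).trans_lt (hr j)
  obtain ⟨k, L, hkL, hks⟩ : ∃ k L, d * q ^ k < 3 ^ L ∧ s₀ * (L + 2) < q ^ k := by
    -- With `L = k * q + d` the second inequality compares a linear function of `k` with `q ^ k`.
    set a := s₀ * (q + d + 2) with ha
    refine ⟨2 * (2 * a + 1), 2 * (2 * a + 1) * q + d, ?_, ?_⟩
    · rw [pow_add, mul_comm (2 * (2 * a + 1)) q, pow_mul 3 q, mul_comm]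
      exact Nat.mul_lt_mul_of_le_of_lt
        (Nat.pow_le_pow_left (Nat.lt_pow_self (by norm_num : 1 < 3)).le _)
        (Nat.lt_pow_self (by norm_num)) (by positivity)
    · have h1 : 2 * a + 1 < 2 ^ (2 * a + 1) := Nat.lt_pow_self (by norm_num)
      calc s₀ * (2 * (2 * a + 1) * q + d + 2)
          ≤ s₀ * (2 * (2 * a + 1) * q + 2 * (2 * a + 1) * d + 2 * (2 * a + 1) * 2) := by
            gcongr
            · exact Nat.le_mul_of_pos_left _ (by omega)
            · omega
        _ = (2 * a) * (2 * a + 1) := by rw [ha]; ring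
        _ < 2 ^ (2 * a + 1) * 2 ^ (2 * a + 1) := by
            exact Nat.mul_lt_mul'' (by omega) h1
        _ = 2 ^ (2 * (2 * a + 1)) := by rw [← pow_add, ← two_mul]
        _ ≤ q ^ (2 * (2 * a + 1)) := Nat.pow_le_pow_left hq _
  set N := d * q ^ k with hN
  have hNpos : 0 < N := by positivity
  have hr₀pos : 0 < r₀ := (hr' 0).trans_le (hr₀ 0)
  have hev : ∀ᶠ j in atTop, ∀ m ∈ Finset.range (N * (s₀ * (L + 2)) + 1), ¬ q ^ k ∣ m →
      μ.real (returnSet T (D.floors j) (E j) N m) < 1 / 2 / r₀ ^ (L + 2) := by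
    rw [eventually_all_finset]
    intro m _
    by_cases hm : q ^ k ∣ m
    · exact .of_forall fun j h => absurd hm h
    · filter_upwards [(hdvd k m hm).eventually
        (gt_mem_nhds (show (0 : ℝ) < 1 / 2 / r₀ ^ (L + 2) by positivity))] with j hj _ using hj
  have hev' := (h.tendsto_measure_tower hT).eventually
    (lt_mem_nhds (show (1 / 2 : ℝ) < 1 by norm_num))
  have hmain : ∀ᶠ j in atTop, ∃ K, ∀ c, c + 1 < D.copies 2 (j + L) →
      D.offset 2 (j + L) (c + 1) = D.offset 2 (j + L) c + K := by
    filter_upwards [hev, hev'] with j hj hj'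
    have hdiv : ∀ i, i + N < D.copies (L + 2) j → ∃ m,
        D.offset (L + 2) j (i + N) = D.offset (L + 2) j i + N * D.floors j + m ∧ q ^ k ∣ m := by
      intro i hi
      obtain ⟨h1, h2⟩ := D.offset_add_bounds hr' hs (L + 2) j N hi
      obtain ⟨m, hm⟩ := Nat.exists_eq_add_of_le h1
      refine ⟨m, hm, ?_⟩
      by_contra hmd
      have h3 := hj m (Finset.mem_range.2 (by omega)) hmd
      have h4 := h.le_measure_returnSet hT hr' (L + 2) j hi hm
      have h5 : (D.copies (L + 2) j : ℝ) ≤ r₀ ^ (L + 2) := by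
        exact_mod_cast D.copies_le_pow hr₀ (L + 2) j
      rw [lt_div_iff₀ (by positivity)] at h3
      have h6 := mul_le_mul_of_nonneg_right h5
        (measureReal_nonneg (μ := μ) (s := returnSet T (D.floors j) (E j) N m))
      linarith
    -- The numbers of spacers after the copies `i` and `i + N` are congruent modulo `q ^ k`, and both
    -- are smaller than `q ^ k`.
    have hper : ∀ i, i + N + 1 < D.copies (L + 2) j →
        D.offset (L + 2) j (i + N + 1) + D.offset (L + 2) j i =
          D.offset (L + 2) j (i + 1) + D.offset (L + 2) j (i + N) := by
      intro i hi
      obtain ⟨m, hm, hmd⟩ := hdiv i (by omega)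
      obtain ⟨m', hm', hmd'⟩ := hdiv (i + 1) (by omega)
      obtain ⟨h1, h2⟩ := D.offset_succ_bounds hr' hs (L + 2) j (i := i) (by omega)
      obtain ⟨h3, h4⟩ := D.offset_succ_bounds hr' hs (L + 2) j (i := i + N) hi
      obtain ⟨g, hg⟩ := Nat.exists_eq_add_of_le h1
      obtain ⟨g', hg'⟩ := Nat.exists_eq_add_of_le h3
      rw [add_right_comm i 1 N] at hm'
      have h5 : m' + g = m + g' := by omega
      have h6 : g ≡ g' [MOD q ^ k] := by
        have h7 : m' + g ≡ 0 + g [MOD q ^ k] := (Nat.modEq_zero_iff_dvd.2 hmd').add_right g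
        have h8 : m + g' ≡ 0 + g' [MOD q ^ k] := (Nat.modEq_zero_iff_dvd.2 hmd).add_right g'
        rw [zero_add] at h7 h8
        exact h7.symm.trans (h5 ▸ h8)
      have h7 : g = g' := h6.eq_of_lt_of_lt (by omega) (by omega)
      omega
    set R := D.copies L j with hR
    have hRN : N < R := hkL.trans_le (D.three_pow_le_copies hr L j)
    obtain ⟨e, he⟩ := Nat.exists_eq_add_of_le
      (D.offset_add_bounds hr' hs L j (i := R - 1 - N) 1 (by omega)).1
    rw [show R - 1 - N + 1 = R - N by omega] at he
    refine ⟨1 * D.floors j + e + D.offset L j (R - 1), fun c hc => ?_⟩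
    have hRc : R * c + R < D.copies (L + 2) j := by
      rw [D.copies_add]
      calc R * c + R = R * (c + 1) := by ring
        _ < _ := Nat.mul_lt_mul_of_pos_left hc (by omega)
    -- The last copy in the group `c` is compared with the copy `N` places before it, which lies in
    -- the same group, so that the gap after it does not depend on `c`.
    have h1 := hper (R * c + (R - 1 - N)) (by omega)
    rw [show R * c + (R - 1 - N) + N + 1 = R * (c + 1) + 0 by rw [mul_add, mul_one]; omega,
      show R * c + (R - 1 - N) + 1 = R * c + (R - N) by omega,
      show R * c + (R - 1 - N) + N = R * c + (R - 1) by omega,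
      D.offset_add hr' L 2 j (c + 1) (by omega), D.offset_add hr' L 2 j c (by omega),
      D.offset_add hr' L 2 j c (by omega), D.offset_add hr' L 2 j c (by omega),
      D.offset_zero_right] at h1
    omega
  obtain ⟨j₀, hj₀⟩ := eventually_atTop.1 hmain
  refine eventually_atTop.2 ⟨j₀ + L, fun j hj => ?_⟩
  obtain ⟨i, rfl⟩ := Nat.exists_eq_add_of_le hj
  have := hj₀ (j₀ + i) (by omega)
  rwa [add_right_comm] at this

/-- If each late tower sees a constant number of spacers between its copies two steps later, then
its copies in all later towers follow each other with a fixed period `K`. So its base is invariant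
under `T^[K]` up to a null set, which total ergodicity excludes. -/
theorem false_of_offset_two_succ (h : IsCuttingStacking D T μ E C) (hT : MeasurePreserving T μ μ)
    (hr : ∀ j, 2 < D.r j) (hTe : ∀ k, 0 < k → Ergodic T^[k] μ)
    (hoff : ∀ᶠ j in atTop, ∃ K, ∀ c, c + 1 < D.copies 2 j →
      D.offset 2 j (c + 1) = D.offset 2 j c + K) : False := by
  have hr' : ∀ j, 0 < D.r j := fun j => (Nat.zero_le 2).trans_lt (hr j)
  obtain ⟨j₀, hj₀⟩ := eventually_atTop.1 hoff
  have hcol : ∀ j, ∀ c < D.r j, D.offset 2 j c = D.colOffset j c := fun j c hc => by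
    rw [RankOneData.offset, Nat.div_eq_of_lt hc, Nat.mod_eq_of_lt hc, D.offset_zero_right, zero_add]
  have hlin : ∀ j ≥ j₀, ∀ c < D.copies 2 j, D.offset 2 j c = c * D.colOffset j 1 := by
    intro j hj c hc
    obtain ⟨K, hK⟩ := hj₀ j hj
    have hlin' : ∀ c < D.copies 2 j, D.offset 2 j c = c * K := by
      intro c hc
      induction c with
      | zero => simp
      | succ c ih => rw [hK c hc, ih (by omega), add_mul, one_mul]
    have h9 := D.three_pow_le_copies hr 2 j
    rw [← hcol j 1 (by have := hr j; omega), hlin' 1 (by omega), one_mul, hlin' c hc]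
  have hcop : ∀ j, D.r j < D.copies 2 j := fun j => by
    have h3 := D.three_pow_le_copies hr 1 (j + 1)
    rw [RankOneData.copies]
    exact (Nat.lt_mul_iff_one_lt_right (hr' j)).2 (by omega)
  have hsucc : ∀ j ≥ j₀, D.colOffset (j + 1) 1 = D.r j * D.colOffset j 1 := by
    intro j hj
    rw [← hlin j hj _ (hcop j), RankOneData.offset, Nat.div_self (hr' j), Nat.mod_self,
      D.colOffset_zero, add_zero, RankOneData.offset,
      Nat.div_eq_of_lt (by have := hr (j + 1); omega),
      Nat.mod_eq_of_lt (by have := hr (j + 1); omega), D.offset_zero_right, zero_add]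
  have hall : ∀ L, ∀ j ≥ j₀, ∀ i < D.copies L j, D.offset L j i = i * D.colOffset j 1 := by
    intro L
    induction L with
    | zero =>
      intro j _ i hi
      obtain rfl : i = 0 := Nat.lt_one_iff.1 hi
      simp
    | succ L ih =>
      intro j hj i hi
      have hmod := Nat.mod_lt i (hr' j)
      rw [RankOneData.offset, ih (j + 1) (by omega) _ (Nat.div_lt_of_lt_mul hi), hsucc j hj,
        ← hcol j _ hmod, hlin j hj _ (hmod.trans (hcop j)), ← mul_assoc, ← add_mul,
        mul_comm _ (D.r j), Nat.div_add_mod]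
  obtain ⟨j, hj, hj1⟩ := ((eventually_ge_atTop j₀).and ((h.tendsto_measure_base hr).eventually
    (gt_mem_nhds zero_lt_one))).exists
  set K := D.colOffset j 1 with hK
  have hKpos : 0 < K := by
    have := D.floors_pos_of_r_pos hr' j
    rw [hK, RankOneData.colOffset]
    omega
  have hle : ∀ L, μ.real (E j \ T^[K] ⁻¹' E j) ≤ μ.real (E (j + L)) := by
    intro L
    rw [← hT.measureReal_image_iterate (D.offset L j (D.copies L j - 1))
      (h.measurableSet_base (j + L))]
    refine measureReal_mono fun x hx => ?_
    have hx1 := hx.1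
    rw [h.base_eq_iUnion_offset hr' L j] at hx1
    simp only [mem_iUnion, exists_prop, Finset.mem_range] at hx1
    obtain ⟨i, hi, z, hz, rfl⟩ := hx1
    by_cases hi1 : i + 1 < D.copies L j
    · refine absurd (h.image_offset_subset hr' L j hi1 ⟨z, hz, ?_⟩) hx.2
      rw [hall L j hj _ hi1, hall L j hj _ hi, ← Function.iterate_add_apply, add_mul, one_mul,
        add_comm]
    · obtain rfl : i = D.copies L j - 1 := by omega
      exact ⟨z, hz, rfl⟩
  have hzero : μ.real (E j \ T^[K] ⁻¹' E j) = 0 := by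
    refine le_antisymm (ge_of_tendsto ((h.tendsto_measure_base hr).comp
      (tendsto_add_atTop_nat j)) (.of_forall fun L => ?_)) measureReal_nonneg
    have := hle L
    rwa [add_comm] at this
  rcases (hTe K hKpos).ae_empty_or_univ_of_ae_le_preimage
    (h.measurableSet_base j).nullMeasurableSet
    (ae_le_set.2 ((measureReal_eq_zero_iff).1 hzero)) with h1 | h1
  · exact (h.measure_base_pos hT hr' j).ne' (by rw [measureReal_congr h1, measureReal_empty])
  · exact hj1.ne (by rw [measureReal_congr h1, probReal_univ])

end IsCuttingStacking

/-! ### Disjointness -/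

theorem IsJoiningForm.swap {μ : Measure X} {S U : X → X} {β : Set X → Set X → ℝ}
    (h : IsJoiningForm μ S U β) : IsJoiningForm μ U S fun A B => β B A where
  union_left A A' B hA hA' hB hd := h.union_right B A A' hB hA hA' hd
  union_right A B B' hA hB hB' hd := h.union_left B B' A hB hB' hA hd
  nonneg A B := h.nonneg B A
  eq_zero A B hAB := h.eq_zero B A fun h' => hAB h'.symm
  preimage A B hA hB := h.preimage B A hB hA
  univ_left := h.univ_right
  univ_right := h.univ_left

open Classical in
/-- The values of a joining on measurable rectangles form a joining form. -/
theorem IsJoining.isJoiningForm {μ : Measure X} [IsProbabilityMeasure μ] {S U : X → X}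
    {ν : Measure (X × X)} (h : IsJoining S U μ μ ν) (hS : Measurable S) (hU : Measurable U) :
    IsJoiningForm μ S U fun A B =>
      if MeasurableSet A ∧ MeasurableSet B then ν.real (A ×ˢ B) else 0 := by
  have hν : ν univ = 1 := by
    rw [← preimage_univ (f := Prod.fst), ← Measure.map_apply measurable_fst .univ, h.map_fst,
      measure_univ]
  have : IsProbabilityMeasure ν := ⟨hν⟩
  constructor
  · constructor
    · intro A A' B hA hA' hB hd
      rw [if_pos ⟨hA.union hA', hB⟩, if_pos ⟨hA, hB⟩, if_pos ⟨hA', hB⟩, union_prod,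
        measureReal_union (hd.set_prod_left B B) (hA'.prod hB)]
    · intro A B B' hA hB hB' hd
      rw [if_pos ⟨hA, hB.union hB'⟩, if_pos ⟨hA, hB⟩, if_pos ⟨hA, hB'⟩, prod_union,
        measureReal_union (hd.set_prod_right A A) (hA.prod hB')]
    · intro A B
      split_ifs
      exacts [measureReal_nonneg, le_rfl]
    · intro A B hAB
      exact if_neg hAB
    · intro A B hA hB
      rw [if_pos ⟨hS hA, hU hB⟩, if_pos ⟨hA, hB⟩, measureReal_def, measureReal_def,
        ← h.invariant.measure_preimage (hA.prod hB).nullMeasurableSet]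
      rfl
  · intro B hB
    rw [if_pos ⟨.univ, hB⟩, univ_prod, ← map_measureReal_apply measurable_snd hB, h.map_snd]
  · intro A hA
    rw [if_pos ⟨hA, .univ⟩, prod_univ, ← map_measureReal_apply measurable_fst hA, h.map_fst]

/-- Joining forms of `T^[p]` and `T^[q]` with `p < q` are products. -/
theorem IsBoundedConstruction.form_eq_mul {μ : Measure X} [IsProbabilityMeasure μ] {T : X ≃ᵐ X}
    (hT : IsBoundedConstruction T μ) (hw : IsWeaklyMixing T μ) {p q : ℕ} (hpq : p < q)
    {β : Set X → Set X → ℝ} (hβ : IsJoiningForm μ T^[p] T^[q] β) {A B : Set X}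
    (hA : MeasurableSet A) (hB : MeasurableSet B) : β A B = μ.real A * μ.real B := by
  classical
  obtain ⟨D, ⟨r₀, s₀, hD⟩, hTμ, E, C, h⟩ := hT
  have hTe : ∀ k, 0 < k → Ergodic T^[k] μ := fun k hk => hw.ergodic_iterate hTμ hk
  rcases Nat.eq_zero_or_pos p with rfl | hp
  · have := (hTe q hpq).eq_mul_of_le_measure (l := fun B => β A B)
      (fun B B' hB hB' hd => hβ.union_right _ _ _ hA hB hB' hd) (fun B _ => hβ.nonneg A B)
      (fun B hB => hβ.le_right hA hB) (fun B hB => hβ.preimage A B hA hB) hB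
    rw [this, hβ.univ_right A hA]
  have hq : 0 < q := hp.trans hpq
  have hr : ∀ j, 2 < D.r j := fun j => (hD j).1
  have hr₀ : ∀ j, D.r j ≤ r₀ := fun j => (hD j).2.1.le
  have hs : ∀ j, ∀ i < D.r j, D.s j i ≤ s₀ := fun j i hi => ((hD j).2.2 i hi).le
  have hext : ∀ γ ∈ extremePoints ℝ {β | IsJoiningForm μ T^[p] T^[q] β},
      γ = fun A B => if MeasurableSet A ∧ MeasurableSet B then μ.real A * μ.real B else 0 := by
    intro γ hγ
    have hγ' : IsJoiningForm μ T^[p] T^[q] γ := hγ.1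
    funext A B
    by_cases hAB : MeasurableSet A ∧ MeasurableSet B
    · rw [if_pos hAB]
      by_contra hne
      obtain ⟨d, p', q', hd, hcop, rfl, rfl⟩ : ∃ d p' q', 0 < d ∧ Nat.Coprime p' q' ∧
          p = d * p' ∧ q = d * q' := by
        obtain ⟨p', q', hcop, h1, h2⟩ := Nat.exists_coprime p q
        exact ⟨p.gcd q, p', q', Nat.gcd_pos_of_pos_left _ hp, hcop, by rw [mul_comm]; exact h1,
          by rw [mul_comm]; exact h2⟩
      have hq2 : 2 ≤ q' := by
        have h1 : p' ≠ 0 := by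
          rintro rfl
          simp at hp
        have h2 : p' < q' := Nat.lt_of_mul_lt_mul_left hpq
        omega
      refine h.false_of_offset_two_succ hTμ hr hTe
        (h.eventually_exists_offset_two_succ hTμ hr hr₀ hs hd hq2 fun k m hm => ?_)
      have := h.tendsto_measure_returnSet_of_not_dvd hTμ hr hs hd hcop hγ'
        (fun t m n hmn => h.tendsto_form_returnSet hTμ hr hTe hp hq hγ
          ⟨A, B, hAB.1, hAB.2, hne⟩ t hmn) k 1 hm
      rwa [one_mul] at this
    · rw [if_neg hAB, hγ'.eq_zero A B hAB]
  rw [hβ.eq_of_forall_extreme hext]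
  exact if_pos ⟨hA, hB⟩

end

theorem theorem2 {X : Type*} [MeasurableSpace X] [StandardBorelSpace X] (μ : Measure X)
    [IsProbabilityMeasure μ] (T : X ≃ᵐ X) (hT : IsBoundedConstruction T μ)
    (hwm : IsWeaklyMixing T μ) (q p : ℕ) (hqp : q ≠ p) :
    AreDisjoint (T^[q]) (T^[p]) μ μ := by
  intro ν hν
  have hform := hν.isJoiningForm (T.measurable.iterate q) (T.measurable.iterate p)
  have hfst : ν.map Prod.fst Set.univ = 1 := by rw [hν.map_fst, measure_univ]
  rw [Measure.map_apply measurable_fst .univ] at hfst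
  have : IsProbabilityMeasure ν := ⟨hfst⟩
  refine (Measure.prod_eq fun A B hA hB => ?_).symm
  have key : ν.real (A ×ˢ B) = μ.real A * μ.real B := by
    rcases hqp.lt_or_gt with hlt | hlt
    · simpa [hA, hB] using hT.form_eq_mul hwm hlt hform hA hB
    · simpa [hA, hB, mul_comm] using hT.form_eq_mul hwm hlt hform.swap hB hA
  rw [← ENNReal.toReal_eq_toReal_iff' (measure_ne_top _ _)
    (ENNReal.mul_ne_top (measure_ne_top _ _) (measure_ne_top _ _)), ENNReal.toReal_mul]
  exact key
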